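/- **Conventions.** We work over $\mathbb C$. Let $X\subset\mathbb P^r$ be an integral (closed, reduced, irreducible) non-degenerate projective variety of dimension $n$. For $k\le r$ let $G(k,r)$ be the Grassmannian of $k$-planes in $\mathbb P^r$, and let $G_k(X)\subset G(k,r)$ be the Zariski closure of the set of $k$-planes spanned by $k+1$ points of $X$. For $h\le k$ let $G_{h,k}(X)\subset G(h,r)$ be the Zariski closure of the set of $h$-planes contained in some $k$-plane belonging to $G_k(X)$, and let $S_k(X)=G_{0,k}(X)\subset\mathbb P^r$, that is, the closure of the union of the $k$-planes belonging to $G_k(X)$. **Theorem 1.8.** Let $1\le h<k\le r$. Suppose that $S_{k-1}(X)\neq\mathbb P^r$ and $$\dim G_{h,k}(X)<(k-h)(h+1)+n(k+1).$$ Then $$\dim G_{h-1,k-1}(X)<(k-h)h+nk,$$ and in particular $$\dim S_{k-h}(X)<n(k-h+1)+k-h.$$ In the case $k=2$, $h=1$ this gives: if $r>2n+1$ and $\dim G_{1,2}(X)<3n+2$, then $\dim S_1(X)<2n+1$. -/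

import Mathlib

open scoped LinearAlgebra.Projectivization

noncomputable section

/-- The common zero locus in the projective space `ℙ(ℂ^σ)` of a set of polynomials in the homogeneous
coordinates (only used for homogeneous polynomials, for which the choice of the representative
`p.rep` of the point `p` is irrelevant). -/
def projZeroLocus {σ : Type} (T : Set (MvPolynomial σ ℂ)) : Set (ℙ ℂ (σ → ℂ)) :=
  {p | ∀ f ∈ T, MvPolynomial.eval p.rep f = 0}

/-- The Zariski topology on the projective space `ℙ(ℂ^σ)`: the closed sets are the common zero loci
of sets of homogeneous polynomials. -/
instance zariskiTopology (σ : Type) : TopologicalSpace (ℙ ℂ (σ → ℂ)) :=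
  TopologicalSpace.ofClosed
    {Z | ∃ T : Set (MvPolynomial σ ℂ), (∀ f ∈ T, ∃ d : ℕ, f.IsHomogeneous d) ∧ Z = projZeroLocus T}
    (by
      refine ⟨{1}, ?_, ?_⟩
      · rintro f rfl
        exact ⟨0, MvPolynomial.isHomogeneous_one σ ℂ⟩
      · ext p
        simp [projZeroLocus])
    (by
      intro A hA
      refine ⟨{f | (∃ d : ℕ, f.IsHomogeneous d) ∧ ∀ p ∈ ⋂₀ A, MvPolynomial.eval p.rep f = 0},
        fun f hf => hf.1, ?_⟩
      apply Set.Subset.antisymm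
      · intro p hp f hf
        exact hf.2 p hp
      · intro p hp Z hZ
        obtain ⟨T, hT, rfl⟩ := hA hZ
        intro f hf
        exact hp f ⟨hT f hf, fun q hq => hq _ hZ f hf⟩)
    (by
      rintro _ ⟨S, hS, rfl⟩ _ ⟨T, hT, rfl⟩
      refine ⟨{f | ∃ s ∈ S, ∃ t ∈ T, f = s * t}, ?_, ?_⟩
      · rintro _ ⟨s, hs, t, ht, rfl⟩
        obtain ⟨d, hd⟩ := hS s hs
        obtain ⟨e, he⟩ := hT t ht
        exact ⟨d + e, hd.mul he⟩
      · apply Set.Subset.antisymm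
        · rintro p hp _ ⟨s, hs, t, ht, rfl⟩
          rcases hp with hp | hp
          · simp [hp s hs]
          · simp [hp t ht]
        · intro p hp
          by_contra hcon
          simp only [Set.mem_union, not_or, projZeroLocus, Set.mem_ofPred_eq, not_forall] at hcon
          obtain ⟨⟨s, hs, hs'⟩, ⟨t, ht, ht'⟩⟩ := hcon
          have h := hp _ ⟨s, hs, t, ht, rfl⟩
          rw [map_mul] at h
          exact (mul_ne_zero hs' ht') h)

/-- Complex projective space of dimension `r`. -/
abbrev ProjSpace (r : ℕ) : Type := ℙ ℂ (Fin (r + 1) → ℂ)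

/-- The Grassmannian `G(h, r)` of projective `h`-planes in projective `r`-space, that is, of
linear subspaces of dimension `h + 1` of `ℂ^(r+1)`. -/
def PlaneGrassmannian (h r : ℕ) : Type :=
  {W : Submodule ℂ (Fin (r + 1) → ℂ) // Module.finrank ℂ W = h + 1}

/-- The Plücker coordinates (maximal minors) of a family of `h + 1` vectors of `ℂ^(r+1)`, indexed by
all sequences of `h + 1` column indices. Those of non-increasing sequences are redundant: they are
`0` or, up to sign, equal to those of increasing sequences. -/
def pluckerVector {h r : ℕ} (v : Fin (h + 1) → Fin (r + 1) → ℂ) :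
    (Fin (h + 1) → Fin (r + 1)) → ℂ :=
  fun s => Matrix.det (Matrix.of fun i j => v i (s j))

theorem pluckerVector_ne_zero {h r : ℕ} (v : Fin (h + 1) → Fin (r + 1) → ℂ)
    (hv : LinearIndependent ℂ v) : pluckerVector v ≠ 0 := by
  intro h0
  -- the columns of the matrix with rows `v i` span `ℂ^(h+1)`
  let M : Matrix (Fin (h + 1)) (Fin (r + 1)) ℂ := Matrix.of v
  have hrank : M.rank = h + 1 := by
    have := LinearIndependent.rank_matrix (M := M) hv
    simpa using this
  have hspan : Submodule.span ℂ (Set.range M.col) = ⊤ := by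
    apply Submodule.eq_top_of_finrank_eq
    rw [← Matrix.rank_eq_finrank_span_cols, hrank]
    simp
  obtain ⟨κ, a, ha, hsp, hli⟩ := exists_linearIndependent' ℂ M.col
  let b : Module.Basis κ ℂ (Fin (h + 1) → ℂ) := Module.Basis.mk hli (by rw [hsp, hspan])
  let e : κ ≃ Fin (h + 1) := b.indexEquiv (Pi.basisFun ℂ (Fin (h + 1)))
  have hdet := congrFun h0 (fun j => a (e.symm j))
  have hcols : LinearIndependent ℂ (M.submatrix id fun j => a (e.symm j)).col :=
    hli.comp e.symm e.symm.injective
  have hu := Matrix.linearIndependent_cols_iff_isUnit.1 hcols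
  rw [Matrix.isUnit_iff_isUnit_det] at hu
  exact hu.ne_zero hdet

namespace PlaneGrassmannian

/-- A basis, indexed by `Fin (h + 1)`, of the linear subspace underlying an `h`-plane. -/
def basis {h r : ℕ} (W : PlaneGrassmannian h r) : Module.Basis (Fin (h + 1)) ℂ W.1 :=
  Module.finBasisOfFinrankEq ℂ W.1 W.2

/-- The Plücker embedding: it sends an `h`-plane to the point whose homogeneous coordinates are the
maximal minors of a basis (another basis multiplies all of them by the same nonzero number). -/
def plucker {h r : ℕ} (W : PlaneGrassmannian h r) : ℙ ℂ ((Fin (h + 1) → Fin (r + 1)) → ℂ) :=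
  Projectivization.mk ℂ (pluckerVector fun i => (W.basis i : Fin (r + 1) → ℂ))
    (pluckerVector_ne_zero _
      (W.basis.linearIndependent.map' W.1.subtype (Submodule.ker_subtype W.1)))

/-- The Zariski topology of the Grassmannian, induced by the Plücker embedding. -/
instance (h r : ℕ) : TopologicalSpace (PlaneGrassmannian h r) :=
  TopologicalSpace.induced plucker inferInstance

end PlaneGrassmannian

/-- `X ⊆ ℙ^r` is an integral (that is, closed, reduced and irreducible) variety which is
non-degenerate (its points span `ℙ^r`) and has dimension `n`. -/
structure IsNondegenerateVariety {r : ℕ} (n : ℕ) (X : Set (ProjSpace r)) : Prop where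
  isClosed : IsClosed X
  isIrreducible : IsIrreducible X
  nondegenerate : (⨆ p ∈ X, p.submodule) = ⊤
  dim_eq : topologicalKrullDim X = n

/-- `G_k(X)`: the Zariski closure in `G(k, r)` of the set of the `(k+1)`-secant `k`-planes of `X`,
that is, of the `k`-planes spanned by `k + 1` points of `X` (which are then linearly independent, as
their span has projective dimension `k`). -/
def secantPlanes {r : ℕ} (X : Set (ProjSpace r)) (k : ℕ) : Set (PlaneGrassmannian k r) :=
  closure {H | ∃ q : Fin (k + 1) → ProjSpace r, (∀ i, q i ∈ X) ∧ H.1 = ⨆ i, (q i).submodule}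

/-- The Grassmannian of secant varieties `G_{h,k}(X)`: the Zariski closure in `G(h, r)` of the set
of the `h`-planes contained in some `k`-plane of `G_k(X)`. -/
def secantGrassmannian {r : ℕ} (X : Set (ProjSpace r)) (h k : ℕ) : Set (PlaneGrassmannian h r) :=
  closure {L | ∃ H ∈ secantPlanes X k, L.1 ≤ H.1}

/-- The secant variety `S_k(X)`: the Zariski closure in `ℙ^r` of the union of all `k`-planes of
`G_k(X)`. -/
def secantVariety {r : ℕ} (X : Set (ProjSpace r)) (k : ℕ) : Set (ProjSpace r) :=
  closure {p | ∃ H ∈ secantPlanes X k, p.submodule ≤ H.1}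

end

/-!
# Secant planes and defects

The dimension count behind the theorem is that of the family of pairs consisting of `k + 1` points
of `X` and of an `h`-plane contained in their span: it has dimension `(k - h)(h + 1) + n(k + 1)`,
so the hypothesis says that the general `h`-plane of `G_{h,k}(X)` lies in infinitely many spans of
this kind. The claim is that this remains true after one of the points, and one dimension of the
plane, have been taken away. The argument is infinitesimal.

* *Generic points.* Let `S` be a chart of `X` and let `η` be a generic point of the space of tuples
  `(p_0, …, p_h, q_1, …, q_c; a)` with `p_i, q_j` in `S` and an `(h + 1) × c` matrix `a`, where
  `k = h + c`. The rows `p_i + ∑_j a_ij q_j` of `secantMatrix η` span the generic `h`-plane in the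
  generic secant plane. Its coordinates in an affine chart of the Grassmannian form the matrix
  `normalForm (secantMatrix η) s`, and the dimension of `G_{h,k}(X)` is their transcendence degree
  (`eRk_normalForm_le_topologicalKrullDim`, `topologicalKrullDim_secantGrassmannian_le`), while the
  expected dimension is that of `η` (`eRk_range_pointFamilies`).
* *Derivations.* In characteristic `0`, the transcendence degree drops exactly if some derivation
  `D` which does not vanish on `η` kills the normal form, that is, if `D M = B M` for the secant
  matrix `M` and some square matrix `B` (`exists_derivation_ne_zero`,
  `exists_map_derivation_eq_mul`).
* *The role of `S_{k-1}(X)`.* If one of the generic points were in the span of the other points and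
  their derivatives, then the projective tangent space of `S_{k-1}(X)` at a general point of the
  span of the other points would contain a general point of `X`, hence everything. Algebraically:
  a form vanishing on the spans of `k` points would have a gradient with the same property, and
  would vanish by induction on its degree (`eq_zero_of_mem_span_tangent`). So this does not
  happen if `S_{k-1}(X) ≠ ℙ^r`.
* *The descent.* The rows of index `i ≥ 1` of `D M = B M` show that `B_{i0} = 0`, since otherwise
  `p_0` would be in the span just described. Hence `D` preserves the row space of the secant matrix
  without its first row, which belongs to one point less. If `D` were zero on the remaining points
  and parameters, then `D p_0` would be a combination of the points, the coefficients of all points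
  except `p_0` would be zero for the same reason, that of `p_0` would be zero as `p_0` has a
  coordinate equal to `1`, and `D` would be zero on `η`
  (`secantMatrix_tail_of_map_derivation_eq_mul`, `eRk_normalForm_tail_lt`).

Repeating the descent until the plane is a point gives the claim about `S_{k-h}(X)`.
-/

open MvPolynomial

/-! ### Transcendence degree and Krull dimension -/

/-- A domain has the Krull dimension of any subring over which it is integral: chains of primes
contract strictly (incomparability), and lift by going up. -/
theorem ringKrullDim_eq_of_integral_injective {A B : Type*} [CommRing A] [CommRing B] [IsDomain B]
    (g : A →+* B) (hg : Function.Injective g) (hi : g.IsIntegral) :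
    ringKrullDim B = ringKrullDim A := by
  let := g.toAlgebra
  have : Algebra.IsIntegral A B := ⟨hi⟩
  apply le_antisymm
  · refine Order.krullDim_le_of_strictMono (PrimeSpectrum.comap g) fun p q hpq => ?_
    obtain ⟨x, hxq, hxp⟩ := SetLike.exists_of_lt (show p.asIdeal < q.asIdeal from hpq)
    exact Ideal.comap_lt_comap_of_integral_mem_sdiff (le_of_lt hpq) ⟨hxq, hxp⟩
      (Algebra.IsIntegral.isIntegral x)
  · refine iSup_le fun l => ?_
    obtain ⟨⟨P, hP⟩, hPl⟩ : ∃ P : PrimeSpectrum B, PrimeSpectrum.comap g P = l.head := by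
      obtain ⟨Q, -, hQ, hQ'⟩ := Ideal.exists_ideal_over_prime_of_isIntegral_of_isPrime
        (S := B) l.head.asIdeal ⊥ (by
          rw [← RingHom.ker_eq_comap_bot]
          exact ((RingHom.injective_iff_ker_eq_bot _).1 hg).le.trans bot_le)
      exact ⟨⟨Q, hQ⟩, PrimeSpectrum.ext hQ'⟩
    have : P.LiesOver (RelSeries.head l).asIdeal := ⟨by rw [← hPl]; rfl⟩
    obtain ⟨L, hL, -⟩ := Ideal.exists_ltSeries_of_hasGoingUp l P
    rw [← hL]
    exact le_iSup (fun p : LTSeries (PrimeSpectrum B) => (p.length : WithBot ℕ∞)) L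

section Rank

variable {K : Type} [Field K] [Algebra ℂ K]

/-- The algebraic matroid of a field extension `K` of `ℂ`: its rank function is the transcendence
degree, and its closure operator is the relative algebraic closure. -/
abbrev algMatroid (K : Type) [Field K] [Algebra ℂ K] : Matroid K :=
  AlgebraicIndependent.matroid ℂ K

theorem adjoin_subset_algMatroid_closure (S : Set K) :
    (IntermediateField.adjoin ℂ S : Set K) ⊆ (algMatroid K).closure S := by
  rw [AlgebraicIndependent.matroid_closure_eq]
  intro x hx
  rw [SetLike.mem_coe, Subalgebra.mem_algebraicClosure]
  induction hx using IntermediateField.adjoin_induction with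
  | mem x hx =>
    exact isAlgebraic_algebraMap (⟨x, Algebra.subset_adjoin hx⟩ : Algebra.adjoin ℂ S)
  | algebraMap x =>
    exact isAlgebraic_algebraMap (algebraMap ℂ (Algebra.adjoin ℂ S) x)
  | add x y _ _ hx hy => exact hx.add hy
  | inv x _ hx => exact hx.inv
  | mul x y _ _ hx hy => exact hx.mul hy

theorem eRk_le_of_subset_adjoin {S T : Set K}
    (h : S ⊆ (IntermediateField.adjoin ℂ T : Set K)) :
    (algMatroid K).eRk S ≤ (algMatroid K).eRk T := by
  rw [← (algMatroid K).eRk_closure_eq T]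
  exact (algMatroid K).eRk_mono (h.trans (adjoin_subset_algMatroid_closure T))

theorem eRk_range_eq_card {ι : Type} [Fintype ι] {x : ι → K} (hx : AlgebraicIndependent ℂ x) :
    (algMatroid K).eRk (Set.range x) = Fintype.card ι := by
  have h : (algMatroid K).Indep (Set.range x) :=
    AlgebraicIndependent.matroid_indep_iff.2 hx.to_subtype_range
  rw [h.eRk_eq_encard, ← Set.image_univ, hx.injective.encard_image, Set.encard_univ]
  simp

/-- The dimension of the affine variety with generic point `y` is the transcendence degree of the
coordinates of `y`. -/
theorem ringKrullDim_quotient_ker_aeval {σ : Type} [Finite σ] (y : σ → K) :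
    ringKrullDim (MvPolynomial σ ℂ ⧸ RingHom.ker (MvPolynomial.aeval (R := ℂ) y)) =
      ((algMatroid K).eRk (Set.range y) : WithBot ℕ∞) := by
  let e : (MvPolynomial σ ℂ ⧸ RingHom.ker (MvPolynomial.aeval (R := ℂ) y)) ≃+*
      (MvPolynomial.aeval (R := ℂ) y).range :=
    (Ideal.quotientKerEquivRange (MvPolynomial.aeval (R := ℂ) y)).toRingEquiv
  rw [ringKrullDim_eq_of_ringEquiv e]
  have : Algebra.FiniteType ℂ (MvPolynomial.aeval (R := ℂ) y).range :=
    Algebra.FiniteType.of_surjective (MvPolynomial.aeval (R := ℂ) y).rangeRestrict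
      (MvPolynomial.aeval (R := ℂ) y).rangeRestrict_surjective
  obtain ⟨s, g, hg, hi⟩ := exists_integral_inj_algHom_of_fg ℂ (MvPolynomial.aeval (R := ℂ) y).range
  rw [ringKrullDim_eq_of_integral_injective g.toRingHom hg hi,
    MvPolynomial.ringKrullDim_of_isNoetherianRing, ringKrullDim_eq_zero_of_field, zero_add]
  let z : Fin s → K := fun i => (g (MvPolynomial.X i) : K)
  have hz : MvPolynomial.aeval z = (MvPolynomial.aeval (R := ℂ) y).range.val.comp g := by
    ext i; simp [z]
  have hzi : AlgebraicIndependent ℂ z := by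
    change Function.Injective (MvPolynomial.aeval z)
    rw [hz]
    exact Subtype.val_injective.comp hg
  have hrange : ∀ w ∈ (MvPolynomial.aeval (R := ℂ) y).range,
      w ∈ IntermediateField.adjoin ℂ (Set.range y) := by
    intro w hw
    rw [← Algebra.adjoin_range_eq_range_aeval] at hw
    exact IntermediateField.algebra_adjoin_le_adjoin ℂ _ hw
  have h1 : (algMatroid K).eRk (Set.range z) ≤ (algMatroid K).eRk (Set.range y) := by
    refine eRk_le_of_subset_adjoin ?_
    rintro _ ⟨i, rfl⟩
    exact hrange _ (g (MvPolynomial.X i)).2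
  have h2 : (algMatroid K).eRk (Set.range y) ≤ (algMatroid K).eRk (Set.range z) := by
    rw [← (algMatroid K).eRk_closure_eq (Set.range z)]
    refine (algMatroid K).eRk_mono ?_
    rintro _ ⟨i, rfl⟩
    rw [AlgebraicIndependent.matroid_closure_eq, SetLike.mem_coe, Subalgebra.mem_algebraicClosure]
    have hy : y i ∈ (MvPolynomial.aeval (R := ℂ) y).range := ⟨MvPolynomial.X i, by simp⟩
    obtain ⟨p, hp, hpy⟩ := hi ⟨y i, hy⟩
    let φ : MvPolynomial (Fin s) ℂ →+* Algebra.adjoin ℂ (Set.range z) :=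
      ((MvPolynomial.aeval (R := ℂ) z).codRestrict (Algebra.adjoin ℂ (Set.range z)) (by
        intro q
        rw [Algebra.adjoin_range_eq_range_aeval]
        exact ⟨q, rfl⟩)).toRingHom
    refine ⟨p.map φ, (hp.map φ).ne_zero, ?_⟩
    have h3 := congrArg (MvPolynomial.aeval (R := ℂ) y).range.val hpy
    rw [map_zero] at h3
    rw [Polynomial.aeval_def, Polynomial.eval₂_map, ← h3]
    have h4 := Polynomial.hom_eval₂ p g.toRingHom
      (MvPolynomial.aeval (R := ℂ) y).range.val.toRingHom ⟨y i, hy⟩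
    refine Eq.trans ?_ h4.symm
    congr 1
    refine RingHom.ext fun q => ?_
    exact congrArg (fun f : MvPolynomial (Fin s) ℂ →ₐ[ℂ] K => f q) hz
  rw [le_antisymm h2 h1, eRk_range_eq_card hzi]
  simp

end Rank

/-! ### Derivations of fields of characteristic zero -/

section Deriv

variable {K : Type} [Field K] [Algebra ℂ K]

/-- A derivation of a field of characteristic zero can be prescribed arbitrarily on a transcendence
basis. -/
theorem exists_derivation_of_isTranscendenceBasis {ι : Type} {x : ι → K}
    (hx : IsTranscendenceBasis ℂ x) (v : ι → K) :
    ∃ D : Derivation ℂ K K, ∀ i, D (x i) = v i := by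
  let R := MvPolynomial ι ℂ
  let : Algebra R K := (MvPolynomial.aeval (R := ℂ) x).toAlgebra
  have hR : ∀ f : R, algebraMap R K f = MvPolynomial.aeval x f := fun _ => rfl
  have : IsScalarTower ℂ R K := IsScalarTower.of_algebraMap_eq fun c => by
    rw [hR, MvPolynomial.algebraMap_eq, MvPolynomial.aeval_C]
  have : FaithfulSMul R K := (faithfulSMul_iff_algebraMap_injective R K).2 hx.1
  let L := FractionRing R
  let : Algebra L K := FractionRing.liftAlgebra R K
  have : IsScalarTower R L K := inferInstance
  have : Algebra.IsAlgebraic L K := by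
    have := hx.isAlgebraic
    let e := (AlgebraicIndependent.aevalEquiv hx.1)
    have : Algebra.IsAlgebraic R K := by
      refine ⟨fun a => ?_⟩
      obtain ⟨p, hp, hpa⟩ := (hx.isAlgebraic).1 a
      refine ⟨p.map e.symm.toRingEquiv.toRingHom,
        (Polynomial.map_ne_zero_iff e.symm.injective).2 hp, ?_⟩
      rw [Polynomial.aeval_def, Polynomial.eval₂_map, ← hpa, Polynomial.aeval_def]
      congr 1
      ext1 q
      obtain ⟨f, rfl⟩ := e.surjective q
      simp [hR, e]
    exact Algebra.IsAlgebraic.extendScalars (IsFractionRing.injective R L)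
  have : CharZero L := charZero_of_injective_algebraMap
    (algebraMap ℂ L).injective
  have : Algebra.FormallyEtale L K := Algebra.FormallyEtale.of_isSeparable L K
  have : Algebra.FormallyEtale R L := Algebra.FormallyEtale.of_isLocalization (nonZeroDivisors R)
  have : Algebra.FormallyEtale R K := Algebra.FormallyEtale.comp R L K
  let d : Derivation ℂ R K := MvPolynomial.mkDerivation ℂ v
  let l : TensorProduct R K (Ω[R⁄ℂ]) →ₗ[K] K := d.liftKaehlerDifferential.liftBaseChange K
  let E := (KaehlerDifferential.tensorKaehlerEquivOfFormallyEtale ℂ R K).symm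
  refine ⟨(l.comp E.toLinearMap).compDer (KaehlerDifferential.D ℂ K), fun i => ?_⟩
  have h1 : x i = algebraMap R K (MvPolynomial.X i) := by rw [hR, MvPolynomial.aeval_X]
  have h2 := KaehlerDifferential.tensorKaehlerEquivOfFormallyEtale_symm_D_algebraMap ℂ R K
    (MvPolynomial.X i)
  rw [← h1] at h2
  refine (congrArg l h2).trans ?_
  simp only [l, LinearMap.liftBaseChange_tmul, Derivation.liftKaehlerDifferential_comp_D, one_smul]
  exact MvPolynomial.mkDerivation_X ℂ v i

theorem Derivation.eqOn_zero_adjoin {D : Derivation ℂ K K} {S : Set K} (h : ∀ x ∈ S, D x = 0)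
    {x : K} (hx : x ∈ IntermediateField.adjoin ℂ S) : D x = 0 := by
  induction hx using IntermediateField.adjoin_induction with
  | mem x hx => exact h x hx
  | algebraMap c => exact D.map_algebraMap c
  | add x y _ _ hx hy => rw [map_add, hx, hy, add_zero]
  | inv x _ hx => rw [D.leibniz_inv, hx, smul_zero]
  | mul x y _ _ hx hy => rw [D.leibniz, hx, hy, smul_zero, smul_zero, add_zero]

theorem Derivation.eqOn_zero_closure {D : Derivation ℂ K K} {S : Set K} (h : ∀ x ∈ S, D x = 0)
    {x : K} (hx : x ∈ (algMatroid K).closure S) : D x = 0 := by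
  rw [AlgebraicIndependent.matroid_closure_eq, SetLike.mem_coe,
    Subalgebra.mem_algebraicClosure] at hx
  let F := IntermediateField.adjoin ℂ S
  have hF : ∀ a : F, D a = 0 := fun a => D.eqOn_zero_adjoin h a.2
  have hxF : IsAlgebraic F x := by
    obtain ⟨p, hp, hpx⟩ := hx
    let φ : Algebra.adjoin ℂ S →+* F :=
      (Subalgebra.inclusion (IntermediateField.algebra_adjoin_le_adjoin ℂ S)).toRingHom
    have hφ : Function.Injective φ :=
      Subalgebra.inclusion_injective (IntermediateField.algebra_adjoin_le_adjoin ℂ S)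
    refine ⟨p.map φ, (Polynomial.map_ne_zero_iff hφ).2 hp, ?_⟩
    rw [Polynomial.aeval_def, Polynomial.eval₂_map, ← hpx]
    rfl
  let D' : Derivation F K K := Derivation.mk
    { toFun := D, map_add' := D.map_add, map_smul' := fun a b => by
        rw [Algebra.smul_def, D.leibniz, RingHom.id_apply, Algebra.smul_def]
        change (a : K) • D b + b • D a = _
        rw [hF, smul_zero, add_zero]; rfl } D.map_one_eq_zero D.leibniz
  change D' x = 0
  have hi := hxF.isIntegral
  have h0 : Polynomial.aeval x (Polynomial.derivative (minpoly F x)) • D' x = 0 := by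
    rw [← D'.map_aeval, minpoly.aeval, map_zero]
  have : CharZero F := charZero_of_injective_algebraMap (algebraMap ℂ F).injective
  exact (smul_eq_zero.1 h0).resolve_left
    ((minpoly.irreducible hi).separable.aeval_derivative_ne_zero (minpoly.aeval F x))

/-- An element which is transcendental over `ℂ(S)` is moved by a derivation that vanishes
on `S`. -/
theorem exists_derivation_ne_zero {S : Set K} {x : K} (hx : x ∉ (algMatroid K).closure S) :
    ∃ D : Derivation ℂ K K, (∀ y ∈ S, D y = 0) ∧ D x ≠ 0 := by
  classical
  obtain ⟨I, hI⟩ := (algMatroid K).exists_isBasis S (Set.subset_univ _)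
  have hx' : x ∉ (algMatroid K).closure I := by rwa [hI.closure_eq_closure]
  have hxI : x ∉ I := fun h => hx' ((algMatroid K).subset_closure I (Set.subset_univ _) h)
  have hi : (algMatroid K).Indep (insert x I) :=
    hI.indep.insert_indep_iff.2 (Or.inl ⟨Set.mem_univ _, hx'⟩)
  obtain ⟨B, hB, hIB⟩ := hi.exists_isBase_superset
  obtain ⟨D, hD⟩ := exists_derivation_of_isTranscendenceBasis
    (AlgebraicIndependent.matroid_isBase_iff.1 hB) (fun b => if (b : K) = x then 1 else 0)
  refine ⟨D, fun y hy => ?_, ?_⟩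
  · refine D.eqOn_zero_closure (S := I) (fun z hz => ?_)
      (hI.subset_closure hy)
    rw [hD ⟨z, hIB (Set.mem_insert_of_mem _ hz)⟩]
    simp only [ite_eq_right_iff]
    rintro rfl
    exact absurd hz hxI
  · rw [hD ⟨x, hIB (Set.mem_insert _ _)⟩]
    simp

end Deriv

/-! ### Zariski closed subsets of projective space and their affine charts -/

theorem aeval_eq_eval_complex {σ : Type*} (x : σ → ℂ) (f : MvPolynomial σ ℂ) :
    aeval x f = eval x f := rfl

theorem aeval_smul_of_isHomogeneous {σ A : Type*} [CommRing A] [Algebra ℂ A]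
    {F : MvPolynomial σ ℂ} {d : ℕ} (hF : F.IsHomogeneous d) (c : A) (x : σ → A) :
    aeval (c • x) F = c ^ d * aeval x F := by
  rw [aeval_def, aeval_def, eval₂_eq, eval₂_eq, Finset.mul_sum]
  refine Finset.sum_congr rfl fun m hm => ?_
  have hd := hF.degree_eq_sum_deg_support hm
  simp only [Pi.smul_apply, smul_eq_mul, mul_pow, Finset.prod_mul_distrib,
    Finset.prod_pow_eq_pow_sum]
  rw [← hd]
  ring

theorem eval_smul_of_isHomogeneous {σ : Type*}
    {F : MvPolynomial σ ℂ} {d : ℕ} (hF : F.IsHomogeneous d) (c : ℂ) (x : σ → ℂ) :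
    eval (c • x) F = c ^ d * eval x F := by
  simpa only [aeval_eq_eval_complex] using aeval_smul_of_isHomogeneous hF c x

theorem eval_rep_mk_eq_zero_iff {σ : Type} {F : MvPolynomial σ ℂ} {d : ℕ}
    (hF : F.IsHomogeneous d) {v : σ → ℂ} (hv : v ≠ 0) :
    eval (Projectivization.mk ℂ v hv).rep F = 0 ↔ eval v F = 0 := by
  obtain ⟨a, ha⟩ := Projectivization.exists_smul_eq_mk_rep ℂ v hv
  rw [← ha, Units.smul_def, eval_smul_of_isHomogeneous hF, mul_eq_zero]
  exact or_iff_right (pow_ne_zero _ a.ne_zero)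

/-- Homogenization of a polynomial with respect to the coordinate `s`. -/
theorem exists_homogenization {σ : Type} (s : σ) (f : MvPolynomial σ ℂ) :
    ∃ (d : ℕ) (F : MvPolynomial σ ℂ), F.IsHomogeneous d ∧
      ∀ {K : Type} [Field K] [Algebra ℂ K] (x : σ → K), x s ≠ 0 →
        aeval x F = x s ^ d * aeval ((x s)⁻¹ • x) f := by
  refine ⟨f.totalDegree, ∑ i ∈ Finset.range (f.totalDegree + 1),
    X s ^ (f.totalDegree - i) * homogeneousComponent i f, ?_, ?_⟩
  · refine IsHomogeneous.sum _ _ _ fun i hi => ?_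
    have h := (isHomogeneous_X_pow (R := ℂ) s (f.totalDegree - i)).mul
      (homogeneousComponent_isHomogeneous i f)
    rwa [Nat.sub_add_cancel (Nat.lt_succ_iff.1 (Finset.mem_range.1 hi))] at h
  · intro K _ _ x hx
    have hsum : aeval ((x s)⁻¹ • x) f = ∑ i ∈ Finset.range (f.totalDegree + 1),
        aeval ((x s)⁻¹ • x) (homogeneousComponent i f) := by
      rw [← map_sum, sum_homogeneousComponent]
    rw [hsum, map_sum, Finset.mul_sum]
    refine Finset.sum_congr rfl fun i hi => ?_
    have hi' : i ≤ f.totalDegree := Nat.lt_succ_iff.1 (Finset.mem_range.1 hi)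
    rw [aeval_smul_of_isHomogeneous (homogeneousComponent_isHomogeneous i f), map_mul, map_pow,
      aeval_X, ← mul_assoc, inv_pow, pow_sub₀ _ hx hi']

theorem isClosed_iff_exists_projZeroLocus {σ : Type} {Z : Set (ℙ ℂ (σ → ℂ))} :
    IsClosed Z ↔ ∃ T : Set (MvPolynomial σ ℂ), (∀ f ∈ T, ∃ d : ℕ, f.IsHomogeneous d) ∧
      Z = projZeroLocus T := by
  rw [← isOpen_compl_iff]
  change (∃ T : Set (MvPolynomial σ ℂ), (∀ f ∈ T, ∃ d : ℕ, f.IsHomogeneous d) ∧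
    Zᶜᶜ = projZeroLocus T) ↔ _
  rw [compl_compl]

theorem isClosed_setOf_eval_rep_eq_zero {σ : Type} {F : MvPolynomial σ ℂ} {d : ℕ}
    (hF : F.IsHomogeneous d) : IsClosed {p : ℙ ℂ (σ → ℂ) | eval p.rep F = 0} := by
  refine isClosed_iff_exists_projZeroLocus.2 ⟨{F}, ?_, ?_⟩
  · rintro _ rfl; exact ⟨d, hF⟩
  · ext p; simp [projZeroLocus]

theorem isOpen_setOf_rep_ne_zero {σ : Type} (s : σ) :
    IsOpen {p : ℙ ℂ (σ → ℂ) | p.rep s ≠ 0} := by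
  have h := (isClosed_setOf_eval_rep_eq_zero (isHomogeneous_X ℂ s)).isOpen_compl
  simpa [Set.compl_def] using h

/-- The part of `S` in the affine chart `x_s ≠ 0`, as a subset of the affine hyperplane `x_s = 1`
of the space of homogeneous coordinates. -/
def affinePart {σ : Type} (s : σ) (S : Set (ℙ ℂ (σ → ℂ))) : Set (σ → ℂ) :=
  {x | x s = 1 ∧ ∀ h : x ≠ 0, Projectivization.mk ℂ x h ∈ S}

section AffinePart

variable {σ : Type} {s : σ} {S : Set (ℙ ℂ (σ → ℂ))}

theorem ne_zero_of_mem_affinePart {x : σ → ℂ} (hx : x ∈ affinePart s S) : x ≠ 0 := by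
  rintro rfl
  exact zero_ne_one hx.1

theorem smul_rep_mem_affinePart {p : ℙ ℂ (σ → ℂ)} (hp : p ∈ S) (hs : p.rep s ≠ 0) :
    (p.rep s)⁻¹ • p.rep ∈ affinePart s S := by
  refine ⟨by simp [hs], fun h => ?_⟩
  convert hp
  conv_rhs => rw [← p.mk_rep]
  rw [Projectivization.mk_eq_mk_iff]
  exact ⟨Units.mk0 _ (inv_ne_zero hs), rfl⟩

theorem exists_mem_affinePart {p : ℙ ℂ (σ → ℂ)} (hp : p ∈ S) (hs : p.rep s ≠ 0) :
    ∃ x ∈ affinePart s S, ∃ hx : x ≠ 0, Projectivization.mk ℂ x hx = p := by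
  have h := smul_rep_mem_affinePart hp hs
  refine ⟨_, h, ne_zero_of_mem_affinePart h, ?_⟩
  conv_rhs => rw [← p.mk_rep]
  rw [Projectivization.mk_eq_mk_iff]
  exact ⟨Units.mk0 _ (inv_ne_zero hs), rfl⟩

theorem rep_mk_ne_zero {x : σ → ℂ} (hx : x ≠ 0) (hs : x s ≠ 0) :
    (Projectivization.mk ℂ x hx).rep s ≠ 0 := by
  obtain ⟨a, ha⟩ := Projectivization.exists_smul_eq_mk_rep ℂ x hx
  rw [← ha, Units.smul_def]
  exact mul_ne_zero a.ne_zero hs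

/-- Irreducibility in terms of polynomials in affine coordinates: those which do not vanish
identically on the chart define nonempty open subsets. -/
theorem exists_mem_affinePart_ne_zero (hS : IsPreirreducible S) {f g : MvPolynomial σ ℂ}
    (hf : ∃ x ∈ affinePart s S, eval x f ≠ 0) (hg : ∃ x ∈ affinePart s S, eval x g ≠ 0) :
    ∃ x ∈ affinePart s S, eval x f ≠ 0 ∧ eval x g ≠ 0 := by
  have key : ∀ f : MvPolynomial σ ℂ, ∃ U : Set (ℙ ℂ (σ → ℂ)), IsOpen U ∧
      ∀ p, p ∈ U ↔ p.rep s ≠ 0 ∧ eval ((p.rep s)⁻¹ • p.rep) f ≠ 0 := by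
    intro f
    obtain ⟨d, F, hF, hFe⟩ := exists_homogenization s f
    refine ⟨_, (isClosed_setOf_eval_rep_eq_zero ((isHomogeneous_X ℂ s).mul hF)).isOpen_compl, ?_⟩
    intro p
    simp only [Set.mem_compl_iff, Set.mem_ofPred_eq, map_mul, eval_X, mul_eq_zero, not_or]
    refine and_congr_right fun h => ?_
    have := hFe p.rep h
    simp only [aeval_eq_eval_complex] at this
    rw [this, mul_eq_zero, not_or]
    exact and_iff_right (pow_ne_zero _ h)
  have key2 : ∀ {f : MvPolynomial σ ℂ} {U : Set (ℙ ℂ (σ → ℂ))},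
      (∀ p, p ∈ U ↔ p.rep s ≠ 0 ∧ eval ((p.rep s)⁻¹ • p.rep) f ≠ 0) →
      (∃ x ∈ affinePart s S, eval x f ≠ 0) → (S ∩ U).Nonempty := by
    rintro f U hU ⟨x, hx, hxf⟩
    have hx0 := ne_zero_of_mem_affinePart hx
    refine ⟨_, hx.2 hx0, (hU _).2 ⟨rep_mk_ne_zero hx0 (by rw [hx.1]; exact one_ne_zero), ?_⟩⟩
    obtain ⟨a, ha⟩ := Projectivization.exists_smul_eq_mk_rep ℂ x hx0
    rw [← ha, Units.smul_def]
    simpa [hx.1, smul_smul] using hxf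
  obtain ⟨U, hUo, hU⟩ := key f
  obtain ⟨V, hVo, hV⟩ := key g
  obtain ⟨p, hpS, hpU, hpV⟩ := hS U V hUo hVo (key2 hU hf) (key2 hV hg)
  exact ⟨_, smul_rep_mem_affinePart hpS ((hU p).1 hpU).1, ((hU p).1 hpU).2, ((hV p).1 hpV).2⟩

theorem isPrime_vanishingIdeal_affinePart (hS : IsPreirreducible S)
    (hne : (affinePart s S).Nonempty) : (vanishingIdeal ℂ (affinePart s S)).IsPrime := by
  refine ⟨fun h => ?_, fun {f g} hfg => ?_⟩
  · obtain ⟨x, hx⟩ := hne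
    have h1 : (1 : MvPolynomial σ ℂ) ∈ vanishingIdeal ℂ (affinePart s S) := by rw [h]; trivial
    simpa using h1 x hx
  · by_contra hcon
    simp only [mem_vanishingIdeal_iff, not_or, not_forall, exists_prop, aeval_eq_eval_complex]
      at hcon hfg
    obtain ⟨x, hx, hxf, hxg⟩ := exists_mem_affinePart_ne_zero hS hcon.1 hcon.2
    have := hfg x hx
    rw [map_mul] at this
    exact mul_ne_zero hxf hxg this

/-- On an irreducible set which meets the chart `x_s ≠ 0`, a homogeneous polynomial that vanishes
on the chart vanishes everywhere. -/
theorem eval_rep_eq_zero_of_affinePart (hS : IsPreirreducible S)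
    (hne : (affinePart s S).Nonempty) {F : MvPolynomial σ ℂ} {d : ℕ} (hF : F.IsHomogeneous d)
    (h : ∀ x ∈ affinePart s S, eval x F = 0) {p : ℙ ℂ (σ → ℂ)} (hp : p ∈ S) :
    eval p.rep F = 0 := by
  obtain ⟨x, hx⟩ := hne
  have hx0 := ne_zero_of_mem_affinePart hx
  have hsub := subset_closure_inter_of_isPreirreducible_of_isOpen hS (isOpen_setOf_rep_ne_zero s)
    ⟨_, hx.2 hx0, rep_mk_ne_zero hx0 (by rw [hx.1]; exact one_ne_zero)⟩
  refine closure_minimal ?_ (isClosed_setOf_eval_rep_eq_zero hF) (hsub hp)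
  rintro q ⟨hq, hqs⟩
  obtain ⟨x, hx, hx0, rfl⟩ := exists_mem_affinePart hq hqs
  exact (eval_rep_mk_eq_zero_iff hF hx0).2 (h x hx)

end AffinePart

/-! ### Dimension of a variety with a given generic point -/

/-- Upper bound for the dimension of a set of points of projective space all of which are
specializations of a point `y` with coordinates in an extension field. -/
theorem topologicalKrullDim_le_of_generic {σ : Type} [Finite σ] (Z : Set (ℙ ℂ (σ → ℂ)))
    {K : Type} [Field K] [Algebra ℂ K] (y : σ → K)
    (hy : ∀ (F : MvPolynomial σ ℂ) (d : ℕ), F.IsHomogeneous d → aeval y F = 0 →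
      ∀ p ∈ Z, eval p.rep F = 0)
    (m : ℕ∞) (hm : ∀ s, y s ≠ 0 → (algMatroid K).eRk (Set.range ((y s)⁻¹ • y)) ≤ m) :
    topologicalKrullDim Z ≤ (m : WithBot ℕ∞) := by
  refine iSup_le fun l => ?_
  -- choose a chart that meets the smallest member of the chain
  obtain ⟨z, hz⟩ := l.head.isIrreducible.nonempty
  obtain ⟨s, hs⟩ : ∃ s, (z : ℙ ℂ (σ → ℂ)).rep s ≠ 0 :=
    Function.ne_iff.1 (z : ℙ ℂ (σ → ℂ)).rep_nonzero
  have hys : y s ≠ 0 := fun h => hs (by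
    simpa using hy (X s) 1 (isHomogeneous_X ℂ s) (by simpa using h) z z.2)
  refine le_trans ?_ (WithBot.coe_le_coe.2 (hm s hys))
  rw [← ringKrullDim_quotient_ker_aeval]
  let P := RingHom.ker (aeval (R := ℂ) ((y s)⁻¹ • y))
  let W : Fin (l.length + 1) → Set (ℙ ℂ (σ → ℂ)) := fun i => Subtype.val '' (l i : Set Z)
  have hWirr : ∀ i, IsPreirreducible (W i) := fun i =>
    (l i).isIrreducible.isPreirreducible.image _ continuous_subtype_val.continuousOn
  have hWz : ∀ i, (z : ℙ ℂ (σ → ℂ)) ∈ W i := fun i => ⟨z, l.head_le i hz, rfl⟩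
  have hWne : ∀ i, (affinePart s (W i)).Nonempty := fun i => ⟨_, smul_rep_mem_affinePart (hWz i) hs⟩
  have hprime := fun i => isPrime_vanishingIdeal_affinePart (hWirr i) (hWne i)
  have hle : ∀ i, P ≤ vanishingIdeal ℂ (affinePart s (W i)) := by
    intro i f hf x hx
    obtain ⟨d, F, hF, hFe⟩ := exists_homogenization s f
    have hx0 := ne_zero_of_mem_affinePart hx
    obtain ⟨w, hw, hwx⟩ := hx.2 hx0
    have h1 := hy F d hF (by rw [hFe y hys, (show aeval ((y s)⁻¹ • y) f = 0 from hf), mul_zero])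
      w w.2
    rw [hwx, eval_rep_mk_eq_zero_iff hF hx0] at h1
    have h2 := hFe x (by rw [hx.1]; exact one_ne_zero)
    rw [hx.1] at h2
    simpa [aeval_eq_eval_complex, h1] using h2.symm
  have hlt : ∀ i j, i < j →
      vanishingIdeal ℂ (affinePart s (W j)) < vanishingIdeal ℂ (affinePart s (W i)) := by
    intro i j hij
    have hlij : l i < l j := l.strictMono hij
    refine lt_of_le_of_ne (vanishingIdeal_anti_mono fun x hx => ⟨hx.1, fun h => ?_⟩) fun heq => ?_
    · exact Set.image_mono (f := Subtype.val) (le_of_lt hlij) (hx.2 h)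
    · refine hlij.not_ge fun w hw => ?_
      obtain ⟨C, hC, hCi⟩ := isClosed_induced_iff.1 (l i).isClosed
      obtain ⟨T, hT, rfl⟩ := isClosed_iff_exists_projZeroLocus.1 hC
      change w ∈ (l i : Set Z)
      rw [← hCi]
      intro F hF
      obtain ⟨d, hd⟩ := hT F hF
      refine eval_rep_eq_zero_of_affinePart (hWirr j) (hWne j) hd ?_ ⟨w, hw, rfl⟩
      have hFi : F ∈ vanishingIdeal ℂ (affinePart s (W i)) := by
        intro x hx
        have hx0 := ne_zero_of_mem_affinePart hx
        obtain ⟨v, hv, hvx⟩ := hx.2 hx0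
        rw [SetLike.mem_coe, ← SetLike.mem_coe, ← hCi] at hv
        have := hv F hF
        rw [hvx, eval_rep_mk_eq_zero_iff hd hx0] at this
        simpa [aeval_eq_eval_complex] using this
      rw [← heq] at hFi
      intro x hx
      simpa [aeval_eq_eval_complex] using hFi x hx
  let f : Fin (l.length + 1) → PrimeSpectrum (MvPolynomial σ ℂ ⧸ P) := fun i =>
    ⟨(vanishingIdeal ℂ (affinePart s (W i.rev))).map (Ideal.Quotient.mk P),
      Ideal.map_isPrime_of_surjective (H := hprime i.rev) Ideal.Quotient.mk_surjective
        (by rw [Ideal.mk_ker]; exact hle _)⟩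
  have hf : StrictMono f := by
    intro i j hij
    have h := hlt _ _ (Fin.rev_lt_rev.2 hij)
    have hcm : ∀ i, ((vanishingIdeal ℂ (affinePart s (W i))).map (Ideal.Quotient.mk P)).comap
        (Ideal.Quotient.mk P) = vanishingIdeal ℂ (affinePart s (W i)) := fun i => by
      rw [Ideal.comap_map_of_surjective _ Ideal.Quotient.mk_surjective, ← RingHom.ker_eq_comap_bot,
        Ideal.mk_ker]
      exact sup_eq_left.2 (hle i)
    refine lt_of_le_of_ne (Ideal.map_mono h.le) fun heq => h.ne ?_
    have := congrArg (fun p : PrimeSpectrum _ => p.asIdeal.comap (Ideal.Quotient.mk P)) heq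
    simpa only [f, hcm] using this
  exact le_iSup (fun p : LTSeries (PrimeSpectrum (MvPolynomial σ ℂ ⧸ P)) => (p.length : WithBot ℕ∞))
    (LTSeries.mk l.length f hf)

/-- A topological space which contains a homeomorphic image of the set of complex points of the
affine variety with ideal `P` has at least the dimension of that variety. -/
theorem ringKrullDim_le_topologicalKrullDim {ρ : Type} [Finite ρ] (P : Ideal (MvPolynomial ρ ℂ))
    {G : Type*} [TopologicalSpace G] (φ : zeroLocus ℂ P → G)
    (hc : ∀ C : Set G, IsClosed C → ∃ T : Set (MvPolynomial ρ ℂ),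
      ∀ x, φ x ∈ C ↔ ∀ f ∈ T, eval x.1 f = 0)
    (hs : ∀ f : MvPolynomial ρ ℂ, ∃ C : Set G, IsClosed C ∧ ∀ x, φ x ∈ C ↔ eval x.1 f = 0) :
    ringKrullDim (MvPolynomial ρ ℂ ⧸ P) ≤ topologicalKrullDim G := by
  have hq : ∀ q : PrimeSpectrum (MvPolynomial ρ ℂ ⧸ P),
      P ≤ q.asIdeal.comap (Ideal.Quotient.mk P) := fun q => by
    conv_lhs => rw [← Ideal.mk_ker (I := P)]
    exact Ideal.comap_mono bot_le
  -- the image of the zero locus of a prime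
  let V : PrimeSpectrum (MvPolynomial ρ ℂ ⧸ P) → Set G := fun q =>
    φ '' {x | x.1 ∈ zeroLocus ℂ (q.asIdeal.comap (Ideal.Quotient.mk P))}
  have hV : ∀ (q : PrimeSpectrum (MvPolynomial ρ ℂ ⧸ P)) (f : MvPolynomial ρ ℂ),
      (∀ x : zeroLocus ℂ P, x.1 ∈ zeroLocus ℂ (q.asIdeal.comap (Ideal.Quotient.mk P)) →
        eval x.1 f = 0) → f ∈ q.asIdeal.comap (Ideal.Quotient.mk P) := by
    intro q f h
    rw [← IsPrime.vanishingIdeal_zeroLocus (K := ℂ) (q.asIdeal.comap (Ideal.Quotient.mk P))]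
    intro x hx
    simpa [aeval_eq_eval_complex] using h ⟨x, zeroLocus_anti_mono (hq q) hx⟩ hx
  have hirr : ∀ q, IsIrreducible (V q) := by
    intro q
    constructor
    · by_contra hne
      rw [Set.not_nonempty_iff_eq_empty, Set.image_eq_empty] at hne
      have h1 := hV q 1 fun x hx => absurd hx (by
        intro hx
        have : x ∈ {x : zeroLocus ℂ P |
            x.1 ∈ zeroLocus ℂ (q.asIdeal.comap (Ideal.Quotient.mk P))} := hx
        rw [hne] at this
        exact this)
      exact (Ideal.ne_top_iff_one _).1 (Ideal.comap_ne_top _ q.2.ne_top) h1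
    · rw [isPreirreducible_iff_isClosed_union_isClosed]
      intro C₁ C₂ h₁ h₂ h12
      obtain ⟨T₁, hT₁⟩ := hc C₁ h₁
      obtain ⟨T₂, hT₂⟩ := hc C₂ h₂
      by_contra hcon
      rw [not_or] at hcon
      have key : ∀ {C : Set G} {T : Set (MvPolynomial ρ ℂ)},
          (∀ x, φ x ∈ C ↔ ∀ f ∈ T, eval x.1 f = 0) → ¬ V q ⊆ C →
          ∃ f ∈ T, f ∉ q.asIdeal.comap (Ideal.Quotient.mk P) := by
        intro C T hT hVC
        obtain ⟨_, ⟨x, hx, rfl⟩, hxC⟩ := Set.not_subset.1 hVC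
        rw [hT] at hxC
        push Not at hxC
        obtain ⟨f, hf, hfx⟩ := hxC
        refine ⟨f, hf, fun hfq => hfx ?_⟩
        simpa [aeval_eq_eval_complex] using hx f hfq
      obtain ⟨f₁, hf₁, hf₁'⟩ := key hT₁ hcon.1
      obtain ⟨f₂, hf₂, hf₂'⟩ := key hT₂ hcon.2
      have hmul : f₁ * f₂ ∈ q.asIdeal.comap (Ideal.Quotient.mk P) := by
        refine hV q _ fun x hx => ?_
        rw [map_mul]
        rcases h12 ⟨x, hx, rfl⟩ with h | h
        · rw [(hT₁ x).1 h f₁ hf₁, zero_mul]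
        · rw [(hT₂ x).1 h f₂ hf₂, mul_zero]
      exact ((q.2.comap (Ideal.Quotient.mk P)).mem_or_mem hmul).elim hf₁' hf₂'
  rw [topologicalKrullDim, ← Order.krullDim_orderDual]
  refine Order.krullDim_le_of_strictMono
    (fun q : PrimeSpectrum (MvPolynomial ρ ℂ ⧸ P) =>
      OrderDual.toDual (α := TopologicalSpace.IrreducibleCloseds G)
        ⟨closure (V q), (hirr q).closure, isClosed_closure⟩) ?_
  intro q q' hqq
  rw [OrderDual.toDual_lt_toDual]
  refine lt_of_le_not_ge ?_ fun hle => ?_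
  · exact closure_mono (Set.image_mono fun x hx =>
      zeroLocus_anti_mono (Ideal.comap_mono (le_of_lt hqq)) hx)
  · obtain ⟨a, haq', haq⟩ := SetLike.exists_of_lt (show q.asIdeal < q'.asIdeal from hqq)
    obtain ⟨f, rfl⟩ := Ideal.Quotient.mk_surjective a
    obtain ⟨C, hC, hCf⟩ := hs f
    refine haq (hV q f fun x hx => (hCf x).1 ?_)
    have h1 : closure (V q') ⊆ C := closure_minimal (by
      rintro _ ⟨x, hx, rfl⟩
      refine (hCf x).2 ?_
      simpa [aeval_eq_eval_complex] using hx f haq') hC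
    exact h1 (hle (subset_closure ⟨x, hx, rfl⟩))

/-- Lower bound for the dimension of a closed set of projective space on which no homogeneous
polynomial vanishes unless it vanishes at `y`. -/
theorem eRk_le_topologicalKrullDim {σ : Type} [Finite σ] {Z : Set (ℙ ℂ (σ → ℂ))} (hZ : IsClosed Z)
    {K : Type} [Field K] [Algebra ℂ K] (y : σ → K) {s : σ} (hys : y s = 1)
    (hy : ∀ (F : MvPolynomial σ ℂ) (d : ℕ), F.IsHomogeneous d →
      (∀ p ∈ Z, eval p.rep F = 0) → aeval y F = 0) :
    ((algMatroid K).eRk (Set.range y) : WithBot ℕ∞) ≤ topologicalKrullDim Z := by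
  rw [← ringKrullDim_quotient_ker_aeval]
  have hx1 : ∀ x ∈ zeroLocus ℂ (RingHom.ker (aeval (R := ℂ) y)), x s = 1 := by
    intro x hx
    have := hx (X s - 1) (by simp [RingHom.mem_ker, hys])
    simpa [sub_eq_zero] using this
  have hx0 : ∀ x ∈ zeroLocus ℂ (RingHom.ker (aeval (R := ℂ) y)), x ≠ 0 := by
    rintro x hx rfl
    exact zero_ne_one (hx1 _ hx)
  obtain ⟨T, hT, rfl⟩ := isClosed_iff_exists_projZeroLocus.1 hZ
  have hmem : ∀ x (hx : x ∈ zeroLocus ℂ (RingHom.ker (aeval (R := ℂ) y))),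
      Projectivization.mk ℂ x (hx0 x hx) ∈ projZeroLocus T := by
    intro x hx F hF
    obtain ⟨d, hd⟩ := hT F hF
    rw [eval_rep_mk_eq_zero_iff hd]
    simpa [aeval_eq_eval_complex] using hx F (hy F d hd fun p hp => hp F hF)
  refine ringKrullDim_le_topologicalKrullDim _ (fun x => ⟨_, hmem x.1 x.2⟩) ?_ ?_
  · intro C hC
    obtain ⟨C', hC', rfl⟩ := isClosed_induced_iff.1 hC
    obtain ⟨T', hT', rfl⟩ := isClosed_iff_exists_projZeroLocus.1 hC'
    refine ⟨T', fun x => forall₂_congr fun F hF => ?_⟩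
    obtain ⟨d, hd⟩ := hT' F hF
    exact eval_rep_mk_eq_zero_iff hd _
  · intro f
    obtain ⟨d, F, hF, hFe⟩ := exists_homogenization s f
    refine ⟨_, (isClosed_setOf_eval_rep_eq_zero hF).preimage continuous_subtype_val, fun x => ?_⟩
    have h := hFe x.1 (by rw [hx1 _ x.2]; exact one_ne_zero)
    rw [hx1 _ x.2] at h
    simp only [one_pow, inv_one, one_smul, one_mul, aeval_eq_eval_complex] at h
    rw [← h]
    exact eval_rep_mk_eq_zero_iff hF _

/-! ### Maximal minors and Plücker coordinates -/

/-- The maximal minors of a matrix with `m` rows, indexed by all sequences of `m` columns. -/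
noncomputable def minors {A ι : Type*} [CommRing A] {m : ℕ} (M : Matrix (Fin m) ι A)
    (s : Fin m → ι) : A :=
  (M.submatrix id s).det

section Minors

variable {A ι : Type*} [CommRing A] {m : ℕ}

theorem pluckerVector_eq_minors {h r : ℕ} (v : Fin (h + 1) → Fin (r + 1) → ℂ) :
    pluckerVector v = minors (Matrix.of v) := rfl

theorem minors_mul (g : Matrix (Fin m) (Fin m) A) (M : Matrix (Fin m) ι A) (s : Fin m → ι) :
    minors (g * M) s = g.det * minors M s := by
  have h : (g * M).submatrix id s = g * M.submatrix id s := by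
    ext i j; simp [Matrix.mul_apply]
  rw [minors, h, Matrix.det_mul, minors]

theorem minors_update (M : Matrix (Fin m) ι A) (s : Fin m → ι) (i : Fin m) (l : ι) :
    minors M (Function.update s i l) = ((M.submatrix id s).adjugate * M) i l := by
  have h1 : M.submatrix id (Function.update s i l) =
      (M.submatrix id s).updateCol i fun a => M a l := by
    ext a b
    rcases eq_or_ne b i with rfl | hb
    · simp
    · simp [Matrix.updateCol_ne hb, Function.update_of_ne hb]
  rw [minors, h1, ← Matrix.cramer_apply, Matrix.cramer_eq_adjugate_mulVec]
  rfl

theorem map_minors {B : Type*} [CommRing B] (f : A →+* B) (M : Matrix (Fin m) ι A)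
    (s : Fin m → ι) : f (minors M s) = minors (M.map f) s := by
  rw [minors, RingHom.map_det]; rfl

theorem minors_eq_one {M : Matrix (Fin m) ι A} {s : Fin m → ι} (h : M.submatrix id s = 1) :
    minors M s = 1 := by
  rw [minors, h, Matrix.det_one]

theorem minors_update_of_submatrix_eq_one {M : Matrix (Fin m) ι A} {s : Fin m → ι}
    (h : M.submatrix id s = 1) (i : Fin m) (l : ι) :
    minors M (Function.update s i l) = M i l := by
  rw [minors_update, h, Matrix.adjugate_one, Matrix.one_mul]

end Minors

section Field

variable {F : Type*} [Field F] {m : ℕ} {ι : Type*}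

theorem exists_minors_ne_zero [Fintype ι] {v : Matrix (Fin m) ι F}
    (hv : LinearIndependent F v.row) : ∃ s, minors v s ≠ 0 := by
  have hrank : v.rank = m := by
    simpa using LinearIndependent.rank_matrix hv
  have hspan : Submodule.span F (Set.range v.col) = ⊤ := by
    apply Submodule.eq_top_of_finrank_eq
    rw [← Matrix.rank_eq_finrank_span_cols, hrank]
    simp
  obtain ⟨κ, a, ha, hsp, hli⟩ := exists_linearIndependent' F v.col
  let b : Module.Basis κ F (Fin m → F) := Module.Basis.mk hli (by rw [hsp, hspan])
  let e : κ ≃ Fin m := b.indexEquiv (Pi.basisFun F (Fin m))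
  have hcols : LinearIndependent F (v.submatrix id fun j => a (e.symm j)).col :=
    hli.comp e.symm e.symm.injective
  have hu := Matrix.linearIndependent_cols_iff_isUnit.1 hcols
  rw [Matrix.isUnit_iff_isUnit_det] at hu
  exact ⟨fun j => a (e.symm j), hu.ne_zero⟩

theorem linearIndependent_row_of_minors_ne_zero {v : Matrix (Fin m) ι F} {s : Fin m → ι}
    (h : minors v s ≠ 0) : LinearIndependent F v.row := by
  have hu : IsUnit (v.submatrix id s) :=
    (Matrix.isUnit_iff_isUnit_det _).2 (isUnit_iff_ne_zero.2 h)
  have := Matrix.linearIndependent_rows_iff_isUnit.2 hu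
  exact LinearIndependent.of_comp (LinearMap.funLeft F F s) this

/-- The normal form of a matrix with respect to the columns `s`: the matrix with the same row space
whose columns `s` form the identity matrix. -/
noncomputable def normalForm (M : Matrix (Fin m) ι F) (s : Fin m → ι) : Matrix (Fin m) ι F :=
  (M.submatrix id s)⁻¹ * M

variable {M : Matrix (Fin m) ι F} {s : Fin m → ι}

theorem submatrix_mul_normalForm (hs : minors M s ≠ 0) :
    M.submatrix id s * normalForm M s = M := by
  rw [normalForm, ← Matrix.mul_assoc, Matrix.mul_nonsing_inv _ (isUnit_iff_ne_zero.2 hs),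
    Matrix.one_mul]

theorem normalForm_submatrix (hs : minors M s ≠ 0) : (normalForm M s).submatrix id s = 1 := by
  rw [← Matrix.nonsing_inv_mul _ (isUnit_iff_ne_zero.2 hs)]
  ext i j
  simp [normalForm, Matrix.mul_apply]

theorem minors_eq_mul_minors_normalForm (hs : minors M s ≠ 0) (t : Fin m → ι) :
    minors M t = minors M s * minors (normalForm M s) t := by
  conv_lhs => rw [← submatrix_mul_normalForm hs, minors_mul]
  rfl

theorem minors_mem_adjoin {K : Type} [Field K] [Algebra ℂ K] (N : Matrix (Fin m) ι K)
    (t : Fin m → ι) :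
    minors N t ∈ IntermediateField.adjoin ℂ (Set.range fun p : Fin m × ι => N p.1 p.2) := by
  rw [minors, Matrix.det_apply]
  refine sum_mem fun σ _ => ?_
  rw [Units.smul_def, zsmul_eq_mul]
  refine mul_mem (intCast_mem _ _) (prod_mem fun i _ => ?_)
  exact IntermediateField.subset_adjoin _ _ ⟨(σ i, t i), rfl⟩

/-- The ratios of the maximal minors of a matrix are rational functions of the entries of its normal
form. -/
theorem eRk_ratio_minors_le {K : Type} [Field K] [Algebra ℂ K] {M : Matrix (Fin m) ι K}
    {s : Fin m → ι} (hs : minors M s ≠ 0) (t : Fin m → ι) :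
    (algMatroid K).eRk (Set.range ((minors M t)⁻¹ • minors M)) ≤
      (algMatroid K).eRk (Set.range fun p : Fin m × ι => normalForm M s p.1 p.2) := by
  refine eRk_le_of_subset_adjoin ?_
  rintro _ ⟨u, rfl⟩
  have h : ((minors M t)⁻¹ • minors M) u =
      (minors (normalForm M s) t)⁻¹ * minors (normalForm M s) u := by
    rw [Pi.smul_apply, smul_eq_mul, minors_eq_mul_minors_normalForm hs t,
      minors_eq_mul_minors_normalForm hs u]
    field_simp
  rw [h]
  exact mul_mem (inv_mem (minors_mem_adjoin _ _)) (minors_mem_adjoin _ _)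

end Field

/-! ### Closed conditions on the Grassmannian -/

/-- The evaluation of a polynomial in the entries of a matrix. -/
noncomputable def evalMatrix {A : Type*} [CommRing A] [Algebra ℂ A] {m n : ℕ}
    (v : Fin m → Fin n → A) (Ψ : MvPolynomial (Fin m × Fin n) ℂ) : A :=
  aeval (fun p : Fin m × Fin n => v p.1 p.2) Ψ

section Grassmannian

variable {h k r : ℕ}

theorem pluckerVector_mul (g : Matrix (Fin (h + 1)) (Fin (h + 1)) ℂ)
    (v : Fin (h + 1) → Fin (r + 1) → ℂ) :
    pluckerVector (fun i => ∑ j, g i j • v j) = g.det • pluckerVector v := by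
  rw [pluckerVector_eq_minors, pluckerVector_eq_minors]
  have : (Matrix.of fun i => ∑ j, g i j • v j) = g * Matrix.of v := by
    ext i l; simp [Matrix.mul_apply, Finset.sum_apply]
  funext s
  rw [this, minors_mul]
  rfl

/-- The Plücker coordinates of a plane can be computed from any family of vectors of it for which
they are not all zero. -/
theorem plucker_eq_mk (W : PlaneGrassmannian h r) {v : Fin (h + 1) → Fin (r + 1) → ℂ}
    (hv : ∀ i, v i ∈ W.1) (hne : pluckerVector v ≠ 0) :
    W.plucker = Projectivization.mk ℂ (pluckerVector v) hne := by
  let g : Matrix (Fin (h + 1)) (Fin (h + 1)) ℂ := fun i j => W.basis.repr ⟨v i, hv i⟩ j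
  have hvg : v = fun i => ∑ j, g i j • (W.basis j : Fin (r + 1) → ℂ) := by
    funext i
    have := congrArg W.1.subtype (W.basis.sum_repr ⟨v i, hv i⟩)
    rw [map_sum] at this
    exact this.symm
  have hpl : pluckerVector v = g.det • pluckerVector fun i => (W.basis i : Fin (r + 1) → ℂ) := by
    conv_lhs => rw [hvg]
    exact pluckerVector_mul g _
  rw [PlaneGrassmannian.plucker, eq_comm, Projectivization.mk_eq_mk_iff']
  exact ⟨g.det, hpl.symm⟩

/-- The `h`-plane spanned by the rows of a matrix which has a nonzero maximal minor. -/
noncomputable def rowPlane (v : Fin (h + 1) → Fin (r + 1) → ℂ) (hv : pluckerVector v ≠ 0) :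
    PlaneGrassmannian h r :=
  ⟨Submodule.span ℂ (Set.range v), by
    obtain ⟨s, hs⟩ := Function.ne_iff.1 hv
    have hli : LinearIndependent ℂ v :=
      linearIndependent_row_of_minors_ne_zero (v := Matrix.of v) (s := s) hs
    rw [finrank_span_eq_card hli, Fintype.card_fin]⟩

/-- Linear combinations, with coefficients `c i`, of the vectors whose coordinates are the Plücker
coordinates `π` of a plane for sequences which differ in one place. For varying `c` they run through
the tuples of vectors of the plane (`coordVectors_mem`, `exists_coordVectors_eq`). -/
noncomputable def coordVectors (c : Fin (h + 1) → (Fin (k + 1) → Fin (r + 1)) × Fin (k + 1) → ℂ)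
    (π : (Fin (k + 1) → Fin (r + 1)) → ℂ) : Fin (h + 1) → Fin (r + 1) → ℂ :=
  fun i l => ∑ q, c i q * π (Function.update q.1 q.2 l)

theorem coordVectors_mem (W : PlaneGrassmannian k r)
    (c : Fin (h + 1) → (Fin (k + 1) → Fin (r + 1)) × Fin (k + 1) → ℂ) (i : Fin (h + 1)) :
    coordVectors c (pluckerVector fun i => (W.basis i : Fin (r + 1) → ℂ)) i ∈ W.1 := by
  let B : Matrix (Fin (k + 1)) (Fin (r + 1)) ℂ := Matrix.of fun i => (W.basis i : Fin (r + 1) → ℂ)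
  have h1 : coordVectors c (pluckerVector fun i => (W.basis i : Fin (r + 1) → ℂ)) i =
      ∑ q : (Fin (k + 1) → Fin (r + 1)) × Fin (k + 1), c i q • ∑ j,
        (B.submatrix id q.1).adjugate q.2 j • (W.basis j : Fin (r + 1) → ℂ) := by
    funext l
    simp only [coordVectors, Finset.sum_apply, Pi.smul_apply, smul_eq_mul]
    refine Finset.sum_congr rfl fun q _ => ?_
    rw [pluckerVector_eq_minors, minors_update]
    rfl
  rw [h1]
  exact W.1.sum_mem fun q _ => W.1.smul_mem _
    (W.1.sum_mem fun j _ => W.1.smul_mem _ (W.basis j).2)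

theorem exists_coordVectors_eq (W : PlaneGrassmannian k r)
    {v : Fin (h + 1) → Fin (r + 1) → ℂ} (hv : ∀ i, v i ∈ W.1) :
    ∃ c : Fin (h + 1) → (Fin (k + 1) → Fin (r + 1)) × Fin (k + 1) → ℂ,
      coordVectors c (pluckerVector fun i => (W.basis i : Fin (r + 1) → ℂ)) = v := by
  classical
  let B : Matrix (Fin (k + 1)) (Fin (r + 1)) ℂ := Matrix.of fun i => (W.basis i : Fin (r + 1) → ℂ)
  have hB : LinearIndependent ℂ B.row :=
    W.basis.linearIndependent.map' W.1.subtype (Submodule.ker_subtype W.1)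
  obtain ⟨s, hs⟩ := exists_minors_ne_zero hB
  let g : Matrix (Fin (h + 1)) (Fin (k + 1)) ℂ := fun i j => W.basis.repr ⟨v i, hv i⟩ j
  have hvg : Matrix.of v = g * B := by
    ext i l
    have := congrFun (congrArg W.1.subtype (W.basis.sum_repr ⟨v i, hv i⟩)) l
    rw [map_sum, Finset.sum_apply] at this
    exact this.symm
  -- `B = det(B_s)⁻¹ B_s adj(B_s) B`
  let C : Matrix (Fin (h + 1)) (Fin (k + 1)) ℂ := (minors B s)⁻¹ • (g * B.submatrix id s)
  have hC : Matrix.of v = C * ((B.submatrix id s).adjugate * B) := by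
    rw [← Matrix.mul_assoc, Matrix.smul_mul, Matrix.mul_assoc g, Matrix.mul_adjugate,
      Matrix.mul_smul, Matrix.mul_one, smul_smul, Matrix.smul_mul]
    rw [show (B.submatrix id s).det = minors B s from rfl, inv_mul_cancel₀ hs, one_smul, hvg]
  refine ⟨fun i q => if q.1 = s then C i q.2 else 0, ?_⟩
  funext i l
  have h2 := congrFun (congrFun hC i) l
  rw [Matrix.of_apply, Matrix.mul_apply] at h2
  rw [h2, coordVectors, Fintype.sum_prod_type, Finset.sum_eq_single s]
  · refine Finset.sum_congr rfl fun j _ => ?_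
    rw [if_pos rfl, pluckerVector_eq_minors, minors_update]
  · intro t _ hts
    exact Finset.sum_eq_zero fun j _ => by rw [if_neg hts, zero_mul]
  · exact fun hcon => absurd (Finset.mem_univ s) hcon

/-- The planes all of whose `(h + 1)`-tuples of vectors satisfy a homogeneous polynomial equation
form a closed subset of the Grassmannian. -/
theorem isClosed_setOf_evalMatrix_eq_zero {Ψ : MvPolynomial (Fin (h + 1) × Fin (r + 1)) ℂ} {d : ℕ}
    (hΨ : Ψ.IsHomogeneous d) :
    IsClosed {W : PlaneGrassmannian k r |
      ∀ v : Fin (h + 1) → Fin (r + 1) → ℂ, (∀ i, v i ∈ W.1) → evalMatrix v Ψ = 0} := by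
  let Φ : (Fin (h + 1) → (Fin (k + 1) → Fin (r + 1)) × Fin (k + 1) → ℂ) →
      MvPolynomial (Fin (k + 1) → Fin (r + 1)) ℂ := fun c =>
    aeval (fun p : Fin (h + 1) × Fin (r + 1) =>
      ∑ q, C (c p.1 q) * X (Function.update q.1 q.2 p.2)) Ψ
  have hΦ : ∀ c, (Φ c).IsHomogeneous (1 * d) := fun c => by
    refine hΨ.aeval _ fun p => ?_
    exact IsHomogeneous.sum _ _ _ fun q _ => isHomogeneous_C_mul_X _ _
  have hΦe : ∀ c π, eval π (Φ c) = evalMatrix (coordVectors c π) Ψ := by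
    intro c π
    rw [← aeval_eq_eval_complex, ← AlgHom.comp_apply, evalMatrix]
    congr 1
    ext p
    simp [coordVectors]
  have heq : {W : PlaneGrassmannian k r |
      ∀ v : Fin (h + 1) → Fin (r + 1) → ℂ, (∀ i, v i ∈ W.1) → evalMatrix v Ψ = 0} =
      ⋂ c, PlaneGrassmannian.plucker ⁻¹' {p | eval p.rep (Φ c) = 0} := by
    ext W
    simp only [Set.mem_ofPred_eq, Set.mem_iInter, Set.mem_preimage]
    have h1 : ∀ c, eval W.plucker.rep (Φ c) = 0 ↔ evalMatrix (coordVectors c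
        (pluckerVector fun i => (W.basis i : Fin (r + 1) → ℂ))) Ψ = 0 := fun c => by
      rw [← hΦe]
      exact eval_rep_mk_eq_zero_iff (hΦ c) _
    simp only [h1]
    constructor
    · exact fun H c => H _ (coordVectors_mem W c)
    · intro H v hv
      obtain ⟨c, rfl⟩ := exists_coordVectors_eq W hv
      exact H c
  rw [heq]
  exact isClosed_iInter fun c => (isClosed_setOf_eval_rep_eq_zero (hΦ c)).preimage
    continuous_induced_dom

end Grassmannian

/-! ### Generic points -/

/-- `η` is a generic point of `Y ⊆ ℂ^τ`, with coordinates in an extension field of `ℂ`: the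
polynomials vanishing at `η` are those which vanish on `Y`. -/
def IsFieldGeneric {τ K : Type} [Field K] [Algebra ℂ K] (Y : Set (τ → ℂ)) (η : τ → K) : Prop :=
  ∀ f : MvPolynomial τ ℂ, aeval η f = 0 ↔ ∀ y ∈ Y, eval y f = 0

/-- Irreducibility in the Zariski topology of a nonempty set of points of `ℂ^τ`, in terms of
polynomials. -/
structure IsIrreducibleSet {τ : Type} (Y : Set (τ → ℂ)) : Prop where
  nonempty : Y.Nonempty
  exists_ne_zero : ∀ f g : MvPolynomial τ ℂ, (∃ y ∈ Y, eval y f ≠ 0) → (∃ y ∈ Y, eval y g ≠ 0) →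
    ∃ y ∈ Y, eval y f ≠ 0 ∧ eval y g ≠ 0

theorem IsIrreducibleSet.exists_isFieldGeneric {τ : Type} {Y : Set (τ → ℂ)}
    (hY : IsIrreducibleSet Y) :
    ∃ (K : Type) (_ : Field K) (_ : Algebra ℂ K) (η : τ → K), IsFieldGeneric Y η := by
  have hp : (vanishingIdeal ℂ Y).IsPrime := by
    refine ⟨fun h => ?_, fun {f g} hfg => ?_⟩
    · obtain ⟨y, hy⟩ := hY.nonempty
      have h1 : (1 : MvPolynomial τ ℂ) ∈ vanishingIdeal ℂ Y := by rw [h]; trivial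
      simpa using h1 y hy
    · by_contra hcon
      simp only [mem_vanishingIdeal_iff, not_or, not_forall, exists_prop] at hcon hfg
      obtain ⟨y, hy, hf, hg⟩ := hY.exists_ne_zero f g hcon.1 hcon.2
      have := hfg y hy
      rw [map_mul] at this
      exact mul_ne_zero hf hg this
  let A := MvPolynomial τ ℂ ⧸ vanishingIdeal ℂ Y
  refine ⟨FractionRing A, inferInstance, inferInstance,
    fun t => algebraMap A (FractionRing A) (Ideal.Quotient.mk _ (X t)), fun f => ?_⟩
  have h : aeval (fun t => algebraMap A (FractionRing A) (Ideal.Quotient.mk _ (X t))) f =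
      algebraMap A (FractionRing A) (Ideal.Quotient.mk _ f) := by
    have : aeval (fun t => algebraMap A (FractionRing A) (Ideal.Quotient.mk _ (X t))) =
        (IsScalarTower.toAlgHom ℂ A (FractionRing A)).comp (Ideal.Quotient.mkₐ ℂ _) := by
      ext t; simp; rfl
    rw [this]; rfl
  rw [h, map_eq_zero_iff _ (IsFractionRing.injective A (FractionRing A)),
    Ideal.Quotient.eq_zero_iff_mem]
  rfl

section Generic

variable {τ τ' K : Type} [Field K] [Algebra ℂ K] {Y : Set (τ → ℂ)} {η : τ → K}

theorem IsFieldGeneric.comp (hη : IsFieldGeneric Y η) {Y' : Set (τ' → ℂ)} (e : τ' → τ)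
    (h1 : ∀ y ∈ Y, y ∘ e ∈ Y') (h2 : ∀ y' ∈ Y', ∃ y ∈ Y, y ∘ e = y') :
    IsFieldGeneric Y' (η ∘ e) := by
  intro f
  rw [← aeval_rename, hη]
  simp only [eval_rename]
  constructor
  · intro h y' hy'
    obtain ⟨y, hy, rfl⟩ := h2 y' hy'
    exact h y hy
  · exact fun h y hy => h _ (h1 y hy)

/-- Two generic points of the same set have the same transcendence degree. -/
theorem IsFieldGeneric.eRk_eq {K' : Type} [Field K'] [Algebra ℂ K'] {η' : τ → K'} [Finite τ]
    (hη : IsFieldGeneric Y η) (hη' : IsFieldGeneric Y η') :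
    (algMatroid K).eRk (Set.range η) = (algMatroid K').eRk (Set.range η') := by
  have hker : RingHom.ker (aeval (R := ℂ) η) = RingHom.ker (aeval (R := ℂ) η') := by
    ext f
    rw [RingHom.mem_ker, RingHom.mem_ker]
    exact (hη f).trans (hη' f).symm
  have h := ringKrullDim_quotient_ker_aeval η
  rw [hker, ringKrullDim_quotient_ker_aeval η'] at h
  exact (WithBot.coe_injective h).symm

end Generic

/-! ### Families of independent points -/

section Family

variable {ι ρ κ : Type}

/-- The families of points of `S ⊆ ℂ^ρ` indexed by `ι`, together with arbitrary parameters indexed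
by `κ`, as a set of points of an affine space. -/
def pointFamilies (ι κ : Type) {ρ : Type} (S : Set (ρ → ℂ)) : Set (ι × ρ ⊕ κ → ℂ) :=
  {y | ∀ j, (fun l => y (Sum.inl (j, l))) ∈ S}

open Classical in
/-- Replaces the point with index `j` of a family by `z`. -/
noncomputable def replacePoint {A : Type*} (u : ι × ρ ⊕ κ → A) (j : ι) (z : ρ → A) :
    ι × ρ ⊕ κ → A :=
  Sum.elim (fun q => if q.1 = j then z q.2 else u (Sum.inl q)) (fun a => u (Sum.inr a))

theorem replacePoint_same {A : Type*} (u : ι × ρ ⊕ κ → A) (j : ι) (z : ρ → A) (l : ρ) :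
    replacePoint u j z (Sum.inl (j, l)) = z l := by
  simp [replacePoint]

theorem replacePoint_of_ne {A : Type*} (u : ι × ρ ⊕ κ → A) {i j : ι} (h : i ≠ j) (z : ρ → A)
    (l : ρ) : replacePoint u j z (Sum.inl (i, l)) = u (Sum.inl (i, l)) := by
  simp [replacePoint, h]

theorem replacePoint_self {A : Type*} (u : ι × ρ ⊕ κ → A) (j : ι) :
    replacePoint u j (fun l => u (Sum.inl (j, l))) = u := by
  funext t
  rcases t with ⟨i, l⟩ | a
  · rcases eq_or_ne i j with rfl | h
    · exact replacePoint_same _ _ _ _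
    · exact replacePoint_of_ne _ h _ _
  · rfl

theorem exists_eval_replacePoint (f : MvPolynomial (ι × ρ ⊕ κ) ℂ) (u : ι × ρ ⊕ κ → ℂ) (j : ι) :
    ∃ g : MvPolynomial ρ ℂ, ∀ z, eval z g = eval (replacePoint u j z) f := by
  refine ⟨aeval (replacePoint (fun t => C (u t)) j X) f, fun z => ?_⟩
  rw [← aeval_eq_eval_complex, ← aeval_eq_eval_complex, ← AlgHom.comp_apply]
  congr 1
  ext t
  rcases t with ⟨i, l⟩ | a
  · rcases eq_or_ne i j with rfl | h
    · simp [replacePoint_same]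
    · simp [replacePoint_of_ne _ h]
  · simp [replacePoint]

theorem replacePoint_mem {S : Set (ρ → ℂ)} {y : ι × ρ ⊕ κ → ℂ} (hy : y ∈ pointFamilies ι κ S)
    {j : ι} {z : ρ → ℂ} (hz : z ∈ S) : replacePoint y j z ∈ pointFamilies ι κ S := by
  intro i
  rcases eq_or_ne i j with rfl | h
  · simpa [replacePoint_same] using hz
  · simpa [replacePoint_of_ne _ h] using hy i

/-- A product of irreducible sets is irreducible. The proof moves two points, at which two given
polynomials do not vanish, towards each other one factor at a time. -/
theorem IsIrreducibleSet.pointFamilies [Finite ι] {S : Set (ρ → ℂ)} (hS : IsIrreducibleSet S) :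
    IsIrreducibleSet (pointFamilies ι κ S) := by
  classical
  have := Fintype.ofFinite ι
  obtain ⟨x₀, hx₀⟩ := hS.nonempty
  refine ⟨⟨Sum.elim (fun q => x₀ q.2) 0, fun j => hx₀⟩, ?_⟩
  rintro f g ⟨u₀, hu₀, hfu₀⟩ ⟨v₀, hv₀, hgv₀⟩
  have key : ∀ J : Finset ι, ∃ u ∈ _root_.pointFamilies ι κ S, ∃ v ∈ _root_.pointFamilies ι κ S,
      eval u f ≠ 0 ∧ eval v g ≠ 0 ∧ ∀ j ∈ J, ∀ l, u (Sum.inl (j, l)) = v (Sum.inl (j, l)) := by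
    intro J
    induction J using Finset.induction_on with
    | empty => exact ⟨u₀, hu₀, v₀, hv₀, hfu₀, hgv₀, by simp⟩
    | insert i J hi ih =>
      obtain ⟨u, hu, v, hv, hfu, hgv, huv⟩ := ih
      obtain ⟨f', hf'⟩ := exists_eval_replacePoint f u i
      obtain ⟨g', hg'⟩ := exists_eval_replacePoint g v i
      obtain ⟨z, hz, h1, h2⟩ := hS.exists_ne_zero f' g'
        ⟨_, hu i, by rwa [hf', replacePoint_self]⟩ ⟨_, hv i, by rwa [hg', replacePoint_self]⟩
      rw [hf'] at h1
      rw [hg'] at h2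
      refine ⟨_, replacePoint_mem hu hz, _, replacePoint_mem hv hz, h1, h2, fun j hj l => ?_⟩
      rcases eq_or_ne j i with rfl | hji
      · rw [replacePoint_same, replacePoint_same]
      · rw [replacePoint_of_ne _ hji, replacePoint_of_ne _ hji,
          huv j (Finset.mem_of_mem_insert_of_ne hj hji)]
  obtain ⟨u, hu, v, hv, hfu, hgv, huv⟩ := key Finset.univ
  -- it remains to choose the parameters
  let φ : ι × ρ ⊕ κ → MvPolynomial κ ℂ :=
    Sum.elim (fun q => C (u (Sum.inl q))) X
  have hφ : ∀ (F : MvPolynomial (ι × ρ ⊕ κ) ℂ) (a : κ → ℂ), eval a (aeval φ F) =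
      eval (Sum.elim (fun q => u (Sum.inl q)) a) F := by
    intro F a
    rw [← aeval_eq_eval_complex, ← aeval_eq_eval_complex, ← AlgHom.comp_apply]
    congr 1
    ext t
    rcases t with q | b <;> simp [φ]
  have hne : aeval φ f * aeval φ g ≠ 0 := by
    refine mul_ne_zero (fun h => hfu ?_) (fun h => hgv ?_)
    · have := hφ f (fun a => u (Sum.inr a))
      rw [h, map_zero] at this
      rw [this]
      congr 2
      funext t; rcases t with q | b <;> rfl
    · have := hφ g (fun a => v (Sum.inr a))
      rw [h, map_zero] at this
      rw [this]
      congr 2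
      funext t
      rcases t with ⟨j, l⟩ | b
      · exact (huv j (Finset.mem_univ j) l).symm
      · rfl
  obtain ⟨a, ha⟩ : ∃ a, eval a (aeval φ f * aeval φ g) ≠ 0 := by
    by_contra hcon
    push Not at hcon
    exact hne (MvPolynomial.funext fun a => by rw [hcon a, map_zero])
  rw [map_mul, hφ, hφ] at ha
  exact ⟨Sum.elim (fun q => u (Sum.inl q)) a, fun j => hu j, left_ne_zero_of_mul ha,
    right_ne_zero_of_mul ha⟩

variable {K : Type} [Field K] [Algebra ℂ K] {S : Set (ρ → ℂ)} {η : ι × ρ ⊕ κ → K}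

theorem IsFieldGeneric.point (hη : IsFieldGeneric (pointFamilies ι κ S) η) (hS : S.Nonempty)
    (j : ι) : IsFieldGeneric S fun l => η (Sum.inl (j, l)) := by
  obtain ⟨x, hx⟩ := hS
  refine hη.comp (fun l => Sum.inl (j, l)) (fun y hy => hy j) fun z hz => ?_
  refine ⟨replacePoint (Sum.elim (fun q => x q.2) 0) j z,
    replacePoint_mem (fun _ => hx) hz, ?_⟩
  funext l
  exact replacePoint_same _ _ _ _

/-- If `S` is not contained in a hyperplane, then the coordinates of one of the independent generic
points satisfy no nontrivial linear relation whose coefficients come from the other ones. -/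
theorem IsFieldGeneric.aeval_eq_zero_of_sum_mul_eq_zero [Fintype ρ]
    (hη : IsFieldGeneric (pointFamilies ι κ S) η)
    (hspan : ∀ c : ρ → ℂ, (∀ x ∈ S, ∑ l, c l * x l = 0) → c = 0) (m : ι)
    (G : ρ → MvPolynomial (ι × ρ ⊕ κ) ℂ)
    (hG : ∀ l y z, eval (replacePoint y m z) (G l) = eval y (G l))
    (h : ∑ l, aeval η (G l) * η (Sum.inl (m, l)) = 0) (l : ρ) : aeval η (G l) = 0 := by
  have h1 : aeval η (∑ l, G l * X (Sum.inl (m, l))) = 0 := by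
    simpa using h
  rw [hη] at h1 ⊢
  intro y hy
  refine congrFun (hspan (fun l => eval y (G l)) fun x hx => ?_) l
  have h2 := h1 _ (replacePoint_mem hy hx (j := m))
  simpa [hG, replacePoint_same] using h2

end Family

/-! ### Transcendence bases of families of independent generic points -/

section Transcendence

variable {ι ρ κ K : Type} [Field K] [Algebra ℂ K] {S : Set (ρ → ℂ)} {η : ι × ρ ⊕ κ → K}

/-- The coordinates of one point in `B`, for every point of the family, and the parameters. -/
def familyCoords (B : Set ρ) (η : ι × ρ ⊕ κ → K) : ι × B ⊕ κ → K :=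
  η ∘ Sum.map (Prod.map id Subtype.val) id

/-- If the coordinates in `B` are algebraically independent on `S`, then those of independent
generic points of `S` are algebraically independent. -/
theorem algebraicIndependent_familyCoords [Finite ι] (hη : IsFieldGeneric (pointFamilies ι κ S) η)
    (B : Set ρ)
    (hB : ∀ f : MvPolynomial B ℂ, (∀ x ∈ S, eval (fun b : B => x b) f = 0) → f = 0) :
    AlgebraicIndependent ℂ (familyCoords B η) := by
  classical
  have := Fintype.ofFinite ι
  rw [algebraicIndependent_iff]
  intro G hG
  by_contra hne
  obtain ⟨u₀, hu₀⟩ : ∃ u, eval u G ≠ 0 := by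
    by_contra hcon
    push Not at hcon
    exact hne (MvPolynomial.funext fun a => by rw [hcon a, map_zero])
  have key : ∀ J : Finset ι, ∃ u, eval u G ≠ 0 ∧
      ∀ j ∈ J, ∃ x ∈ S, ∀ b : B, u (Sum.inl (j, b)) = x b := by
    intro J
    induction J using Finset.induction_on with
    | empty => exact ⟨u₀, hu₀, by simp⟩
    | insert i J hi ih =>
      obtain ⟨u, hu, huJ⟩ := ih
      obtain ⟨g, hg⟩ := exists_eval_replacePoint G u i
      obtain ⟨x, hx, hxg⟩ : ∃ x ∈ S, eval (fun b : B => x b) g ≠ 0 := by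
        by_contra hcon
        push Not at hcon
        have h1 := hg fun b => u (Sum.inl (i, b))
        rw [hB g hcon, map_zero, replacePoint_self] at h1
        exact hu h1.symm
      rw [hg] at hxg
      refine ⟨_, hxg, fun j hj => ?_⟩
      rcases eq_or_ne j i with rfl | hji
      · exact ⟨x, hx, fun b => replacePoint_same _ _ _ _⟩
      · obtain ⟨x', hx', h'⟩ := huJ j (Finset.mem_of_mem_insert_of_ne hj hji)
        exact ⟨x', hx', fun b => by rw [replacePoint_of_ne _ hji, h']⟩
  obtain ⟨u, hu, huS⟩ := key Finset.univ
  choose x hx hxu using fun j => huS j (Finset.mem_univ j)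
  rw [familyCoords, ← aeval_rename, hη] at hG
  refine hu ?_
  have h1 := hG (Sum.elim (fun q => x q.1 q.2) fun a => u (Sum.inr a)) fun j => hx j
  rw [eval_rename] at h1
  rw [← h1]
  congr 2
  funext t
  rcases t with ⟨j, b⟩ | a
  · exact hxu j b
  · rfl

variable [Finite ρ]

/-- A set of coordinates which form a transcendence basis of the function field of `S`. -/
theorem exists_coords_of_isFieldGeneric {K₀ : Type} [Field K₀] [Algebra ℂ K₀] {ξ : ρ → K₀}
    (hξ : IsFieldGeneric S ξ) : ∃ B : Set ρ,
      (∀ f : MvPolynomial B ℂ, (∀ x ∈ S, eval (fun b : B => x b) f = 0) → f = 0) ∧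
      (algMatroid K₀).eRk (Set.range ξ) = B.encard ∧
      ∀ {K : Type} [Field K] [Algebra ℂ K] (p : ρ → K), IsFieldGeneric S p →
        ∀ l, p l ∈ (algMatroid K).closure (p '' B) := by
  obtain ⟨I, hI⟩ := (algMatroid K₀).exists_isBasis (Set.range ξ) (Set.subset_univ _)
  obtain ⟨B, -, hB⟩ := Set.exists_subset_bijOn (ξ ⁻¹' I) ξ
  rw [Set.image_preimage_eq_of_subset hI.subset] at hB
  have hind : AlgebraicIndependent ℂ fun b : B => ξ b := by
    have h1 := AlgebraicIndependent.matroid_indep_iff.1 hI.indep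
    exact AlgebraicIndependent.comp h1 (fun b : B => (⟨ξ b, hB.mapsTo b.2⟩ : I))
      fun b c hbc => Subtype.ext (hB.injOn b.2 c.2 (congrArg Subtype.val hbc))
  have hB0 : ∀ f : MvPolynomial B ℂ, (∀ x ∈ S, eval (fun b : B => x b) f = 0) → f = 0 := by
    intro f hf
    refine (algebraicIndependent_iff.1 hind) f ?_
    have h2 := (hξ (rename Subtype.val f)).2 fun x hx => by
      rw [eval_rename]; exact hf x hx
    rwa [aeval_rename] at h2
  have hrank : (algMatroid K₀).eRk (Set.range ξ) = B.encard := by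
    rw [hI.eRk_eq_encard, ← hB.image_eq, hB.injOn.encard_image]
  refine ⟨B, hB0, hrank, fun {K} _ _ p hp l => ?_⟩
  have hind' : AlgebraicIndependent ℂ fun b : B => p b := by
    rw [algebraicIndependent_iff]
    intro f hf
    refine hB0 f fun x hx => ?_
    have h2 := (hp (rename Subtype.val f)).1 (by rw [aeval_rename]; exact hf) x hx
    rwa [eval_rename] at h2
  have hrange : (Set.range fun b : B => p b) = p '' B := by
    rw [Set.image_eq_range]
  have hfin : (p '' B).Finite := B.toFinite.image p
  have hinj : Set.InjOn p B := fun b hb c hc hbc =>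
    congrArg Subtype.val (hind'.injective (a₁ := ⟨b, hb⟩) (a₂ := ⟨c, hc⟩) hbc)
  have h3 : (algMatroid K).Indep (p '' B) := by
    rw [← hrange]
    exact AlgebraicIndependent.matroid_indep_iff.2 hind'.to_subtype_range
  have h4 : (algMatroid K).eRk (Set.range p) ≤ (algMatroid K).eRk (p '' B) := by
    rw [h3.eRk_eq_encard, hinj.encard_image, hp.eRk_eq hξ, hrank]
  rw [((algMatroid K).isRkFinite_of_finite hfin).closure_eq_closure_of_subset_of_eRk_ge_eRk
    (Set.image_subset_range p B) h4]
  exact (algMatroid K).subset_closure _ (Set.subset_univ _) ⟨l, rfl⟩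

/-- The transcendence degree of a family of independent generic points is the number of
parameters plus the number of points times the dimension of `S`. -/
theorem eRk_range_pointFamilies [Finite ι] [Finite κ]
    (hη : IsFieldGeneric (pointFamilies ι κ S) η) (hS : S.Nonempty)
    {K₀ : Type} [Field K₀] [Algebra ℂ K₀] {ξ : ρ → K₀} (hξ : IsFieldGeneric S ξ) {n : ℕ}
    (hn : (algMatroid K₀).eRk (Set.range ξ) = n) :
    (algMatroid K).eRk (Set.range η) = (Nat.card ι * n + Nat.card κ : ℕ) := by
  classical
  have := Fintype.ofFinite ι
  have := Fintype.ofFinite κ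
  have := Fintype.ofFinite ρ
  obtain ⟨B, hB, hBn, hcl⟩ := exists_coords_of_isFieldGeneric hξ
  have hind := algebraicIndependent_familyCoords hη B hB
  have hle : Set.range (familyCoords B η) ⊆ Set.range η := by
    rintro _ ⟨t, rfl⟩; exact ⟨_, rfl⟩
  have hge : Set.range η ⊆ (algMatroid K).closure (Set.range (familyCoords B η)) := by
    rintro _ ⟨⟨j, l⟩ | a, rfl⟩
    · refine (algMatroid K).closure_subset_closure ?_ (hcl _ (hη.point hS j) l)
      rintro _ ⟨b, hb, rfl⟩
      exact ⟨Sum.inl (j, ⟨b, hb⟩), rfl⟩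
    · exact (algMatroid K).subset_closure _ (Set.subset_univ _) ⟨Sum.inr a, rfl⟩
  have h1 : (algMatroid K).eRk (Set.range η) =
      (algMatroid K).eRk (Set.range (familyCoords B η)) := by
    refine le_antisymm ?_ ((algMatroid K).eRk_mono hle)
    rw [← (algMatroid K).eRk_closure_eq (Set.range (familyCoords B η))]
    exact (algMatroid K).eRk_mono hge
  have hBcard : Fintype.card B = n := by
    rw [hBn, Set.encard_eq_coe_toFinset_card, Set.toFinset_card] at hn
    exact_mod_cast hn
  rw [h1, eRk_range_eq_card hind, Fintype.card_sum, Fintype.card_prod, hBcard,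
    Nat.card_eq_fintype_card, Nat.card_eq_fintype_card]

/-- A derivation can be modified so as to move only one of the points of a family of independent
generic points. -/
theorem exists_derivation_moving_point [Finite ι]
    (hη : IsFieldGeneric (pointFamilies ι κ S) η) (hS : IsIrreducibleSet S)
    (D : Derivation ℂ K K) (j : ι) :
    ∃ D' : Derivation ℂ K K, (∀ l, D' (η (Sum.inl (j, l))) = D (η (Sum.inl (j, l)))) ∧
      ∀ i ≠ j, ∀ l, D' (η (Sum.inl (i, l))) = 0 := by
  classical
  obtain ⟨K₀, _, _, ξ, hξ⟩ := hS.exists_isFieldGeneric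
  obtain ⟨B, hB, -, hcl⟩ := exists_coords_of_isFieldGeneric hξ
  have hind := algebraicIndependent_familyCoords hη B hB
  obtain ⟨E, hE, hsub⟩ := (AlgebraicIndependent.matroid_indep_iff.2
    hind.to_subtype_range : (algMatroid K).Indep _).exists_isBase_superset
  let I : Set K := (fun l => η (Sum.inl (j, l))) '' B
  obtain ⟨D', hD'⟩ := exists_derivation_of_isTranscendenceBasis
    (AlgebraicIndependent.matroid_isBase_iff.1 hE) (fun b => if (b : K) ∈ I then D b else 0)
  refine ⟨D', fun l => ?_, fun i hi l => ?_⟩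
  · have h1 := Derivation.eqOn_zero_closure (D := D' - D) (S := I) ?_
      (hcl _ (hη.point hS.nonempty j) l)
    · simpa [sub_eq_zero] using h1
    · rintro _ ⟨b, hb, rfl⟩
      have h2 := hD' ⟨η (Sum.inl (j, b)), hsub ⟨Sum.inl (j, ⟨b, hb⟩), rfl⟩⟩
      rw [if_pos ⟨b, hb, rfl⟩] at h2
      simpa [sub_eq_zero] using h2
  · refine Derivation.eqOn_zero_closure (S := (fun l => η (Sum.inl (i, l))) '' B) ?_
      (hcl _ (hη.point hS.nonempty i) l)
    rintro _ ⟨b, hb, rfl⟩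
    have h2 := hD' ⟨η (Sum.inl (i, b)), hsub ⟨Sum.inl (i, ⟨b, hb⟩), rfl⟩⟩
    rw [if_neg] at h2
    · exact h2
    · rintro ⟨b', hb', h3⟩
      have h4 := hind.injective (a₁ := Sum.inl (j, ⟨b', hb'⟩)) (a₂ := Sum.inl (i, ⟨b, hb⟩)) h3
      simp only [Sum.inl.injEq, Prod.mk.injEq] at h4
      exact hi h4.1.symm

end Transcendence

/-! ### Infinitesimal argument for the span of the tangent spaces -/

theorem Derivation.map_mvPolynomial_aeval {σ A : Type*} [Fintype σ] [CommRing A] [Algebra ℂ A]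
    (D : Derivation ℂ A A) (w : σ → A) (F : MvPolynomial σ ℂ) :
    D (aeval w F) = ∑ l, aeval w (pderiv l F) * D (w l) := by
  classical
  induction F using MvPolynomial.induction_on with
  | C a => simp
  | add p q hp hq => simp [hp, hq, add_mul, Finset.sum_add_distrib]
  | mul_X p i hp =>
    have h1 : ∀ l, aeval w (pderiv l (p * X i)) * D (w l) =
        w i * (aeval w (pderiv l p) * D (w l)) + if l = i then aeval w p * D (w i) else 0 := by
      intro l
      rw [pderiv_mul, pderiv_X, map_add, map_mul, map_mul, aeval_X]
      rcases eq_or_ne l i with rfl | hl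
      · simp; ring
      · simp [hl, hl.symm]; ring
    simp only [h1, Finset.sum_add_distrib, ← Finset.mul_sum, ← hp, Finset.sum_ite_eq',
      Finset.mem_univ, if_true, map_mul, aeval_X, D.leibniz, smul_eq_mul]
    ring

/-- The restriction of a polynomial to the line through `u` with direction `w`. -/
noncomputable def restrictLine {σ K : Type*} [Field K] [Algebra ℂ K] (u w : σ → K)
    (F : MvPolynomial σ ℂ) : Polynomial K :=
  aeval (fun l => Polynomial.C (u l) + Polynomial.X * Polynomial.C (w l)) F

theorem eval_restrictLine {σ K : Type*} [Field K] [Algebra ℂ K] (u w : σ → K)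
    (F : MvPolynomial σ ℂ) (ε : K) :
    (restrictLine u w F).eval ε = aeval (fun l => u l + ε * w l) F := by
  have h : ((Polynomial.aeval (R := K) ε).restrictScalars ℂ).comp
      (aeval fun l => Polynomial.C (u l) + Polynomial.X * Polynomial.C (w l)) =
      aeval fun l => u l + ε * w l := by
    ext l
    simp
    ring
  rw [← h, AlgHom.comp_apply, AlgHom.restrictScalars_apply, Polynomial.coe_aeval_eq_eval]
  rfl

/-- A polynomial which vanishes at infinitely many complex points of a line vanishes on it. -/
theorem restrictLine_eq_zero {σ K : Type*} [Field K] [Algebra ℂ K] (u w : σ → K)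
    (F : MvPolynomial σ ℂ) {E : Set ℂ} (hE : E.Finite)
    (h : ∀ ε ∉ E, aeval (fun l => u l + algebraMap ℂ K ε * w l) F = 0) :
    restrictLine u w F = 0 := by
  refine Polynomial.eq_zero_of_infinite_isRoot _ ?_
  refine ((Set.Infinite.image (f := algebraMap ℂ K) (algebraMap ℂ K).injective.injOn
    hE.infinite_compl)).mono ?_
  rintro _ ⟨ε, hε, rfl⟩
  rw [Set.mem_ofPred_eq, Polynomial.IsRoot, eval_restrictLine, h ε hε]

theorem eval_derivative_restrictLine {σ K : Type*} [Fintype σ] [Field K] [Algebra ℂ K] (u w : σ → K)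
    (F : MvPolynomial σ ℂ) :
    (Polynomial.derivative (restrictLine u w F)).eval 0 = ∑ l, aeval u (pderiv l F) * w l := by
  have h := Derivation.map_mvPolynomial_aeval
    ((Polynomial.derivative' (R := K)).restrictScalars ℂ)
    (fun l => Polynomial.C (u l) + Polynomial.X * Polynomial.C (w l)) F
  refine (congrArg (Polynomial.eval 0) h).trans ?_
  rw [Polynomial.eval_finsetSum]
  refine Finset.sum_congr rfl fun l _ => ?_
  rw [Polynomial.eval_mul]
  congr 1
  · have := eval_restrictLine u w (pderiv l F) 0
    simpa [restrictLine] using this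
  · change Polynomial.eval 0 (Polynomial.derivative _) = _
    simp

section Key

variable {ι ρ κ K : Type} [Field K] [Algebra ℂ K] [Fintype ι] [Fintype ρ] {S : Set (ρ → ℂ)}
  {η : ι × ρ ⊕ κ → K}

/-- If one of the generic points lies in the span of the tangent spaces at the others, then no
nonzero form vanishes on the linear span of these. A form `F` which does has vanishing
derivatives along all the tangent spaces, hence along the remaining generic point, which forces its
gradient to vanish. -/
theorem eq_zero_of_mem_span_tangent (hη : IsFieldGeneric (pointFamilies ι κ S) η)
    (hS : IsIrreducibleSet S)
    (hspan : ∀ c : ρ → ℂ, (∀ x ∈ S, ∑ l, c l * x l = 0) → c = 0) (m : ι) (D : Derivation ℂ K K)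
    (hm : (fun l => η (Sum.inl (m, l))) ∈ Submodule.span K
      {w : ρ → K | ∃ j ≠ m, w = (fun l => η (Sum.inl (j, l))) ∨
        w = fun l => D (η (Sum.inl (j, l)))})
    (d : ℕ) : ∀ F : MvPolynomial ρ ℂ, F.IsHomogeneous d →
      (∀ (b : ι → ℂ) (x : ι → ρ → ℂ), b m = 0 → (∀ j, x j ∈ S) → eval (∑ j, b j • x j) F = 0) →
      F = 0 := by
  classical
  induction d with
  | zero =>
    intro F hF h
    obtain ⟨x, hx⟩ := hS.nonempty
    rw [← totalDegree_zero_iff_isHomogeneous, totalDegree_eq_zero_iff_eq_C] at hF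
    have h1 := h 0 (fun _ => x) rfl fun _ => hx
    rw [hF, eval_C] at h1
    rw [hF, h1, map_zero]
  | succ d ih =>
    intro F hF h
    have hd : ∀ l, pderiv l F = 0 := by
      intro l
      refine ih _ hF.pderiv ?_
      -- the point `∑ b_j p_j` as a vector of polynomials
      let P : (ι → ℂ) → ρ → MvPolynomial (ι × ρ ⊕ κ) ℂ := fun b l =>
        ∑ j, C (b j) * X (Sum.inl (j, l))
      let y : (ι → ℂ) → ρ → K := fun b l => ∑ j, algebraMap ℂ K (b j) * η (Sum.inl (j, l))
      have hPy : ∀ b (G : MvPolynomial ρ ℂ), aeval η (aeval (P b) G) = aeval (y b) G := by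
        intro b G
        rw [← AlgHom.comp_apply]
        congr 1
        ext l
        simp [P, y]
      have hPe : ∀ b (G : MvPolynomial ρ ℂ) (z : ι × ρ ⊕ κ → ℂ), eval z (aeval (P b) G) =
          eval (∑ j, b j • fun l => z (Sum.inl (j, l))) G := by
        intro b G z
        rw [← aeval_eq_eval_complex, ← aeval_eq_eval_complex, ← AlgHom.comp_apply]
        congr 1
        ext l
        simp [P, Finset.sum_apply]
      have hFy : ∀ b, b m = 0 → aeval (y b) F = 0 := by
        intro b hb
        rw [← hPy, hη]
        intro z hz
        rw [hPe]
        exact h b _ hb hz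
      -- derivative in the direction of the points
      have h1 : ∀ b, b m = 0 → ∀ j ≠ m,
          ∑ l, aeval (y b) (pderiv l F) * η (Sum.inl (j, l)) = 0 := by
        intro b hb j hj
        rw [← eval_derivative_restrictLine, restrictLine_eq_zero (y b) _ F Set.finite_empty,
          map_zero, Polynomial.eval_zero]
        intro ε _
        rw [← hFy (b + Pi.single j ε) (by simp [hb, hj.symm])]
        congr 2
        funext l
        have h2 : ∀ i, algebraMap ℂ K ((b + Pi.single j ε : ι → ℂ) i) * η (Sum.inl (i, l)) =
            algebraMap ℂ K (b i) * η (Sum.inl (i, l)) +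
              if i = j then algebraMap ℂ K ε * η (Sum.inl (j, l)) else 0 := by
          intro i
          rcases eq_or_ne i j with rfl | hi
          · simp [add_mul]
          · simp [hi]
        simp only [y, h2, Finset.sum_add_distrib, Finset.sum_ite_eq', Finset.mem_univ, if_true]
      -- derivative in the direction of the tangent vectors
      have h2 : ∀ b, b m = 0 → (∀ j ≠ m, b j ≠ 0) → ∀ j ≠ m,
          ∑ l, aeval (y b) (pderiv l F) * D (η (Sum.inl (j, l))) = 0 := by
        intro b hb hb' j hj
        obtain ⟨D', hD', hD''⟩ := exists_derivation_moving_point hη hS D j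
        have h3 := D'.map_mvPolynomial_aeval (y b) F
        have h4 : ∀ l, D' (y b l) = algebraMap ℂ K (b j) * D (η (Sum.inl (j, l))) := by
          intro l
          rw [map_sum, Finset.sum_eq_single j]
          · rw [D'.leibniz, D'.map_algebraMap, hD']; simp
          · intro i _ hi
            rw [D'.leibniz, D'.map_algebraMap, hD'' i hi]; simp
          · simp
        rw [hFy b hb, map_zero] at h3
        simp only [h4] at h3
        have h5 : algebraMap ℂ K (b j) *
            ∑ l, aeval (y b) (pderiv l F) * D (η (Sum.inl (j, l))) = 0 := by
          rw [h3, Finset.mul_sum]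
          exact Finset.sum_congr rfl fun l _ => by ring
        exact (mul_eq_zero.1 h5).resolve_left
          ((map_ne_zero_iff _ (algebraMap ℂ K).injective).2 (hb' j hj))
      have h3 : ∀ b, b m = 0 → (∀ j ≠ m, b j ≠ 0) → ∀ l, aeval (y b) (pderiv l F) = 0 := by
        intro b hb hb' l
        have h4 : ∑ l, aeval (y b) (pderiv l F) * η (Sum.inl (m, l)) = 0 := by
          refine Submodule.span_induction (p := fun (w : ρ → K) _ =>
            ∑ l, aeval (y b) (pderiv l F) * w l = 0) ?_ ?_ ?_ ?_ hm
          · rintro _ ⟨j, hj, rfl | rfl⟩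
            · exact h1 b hb j hj
            · exact h2 b hb hb' j hj
          · simp
          · intro u v _ _ hu hv
            simp only [Pi.add_apply, mul_add, Finset.sum_add_distrib, hu, hv, add_zero]
          · intro a u _ hu
            simp only [Pi.smul_apply, smul_eq_mul, mul_left_comm _ a, ← Finset.mul_sum, hu,
              mul_zero]
        rw [← hPy]
        refine hη.aeval_eq_zero_of_sum_mul_eq_zero hspan m (fun l => aeval (P b) (pderiv l F))
          ?_ (by simpa only [hPy] using h4) l
        intro l u z
        rw [hPe, hPe]
        congr 2
        refine Finset.sum_congr rfl fun j _ => ?_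
        rcases eq_or_ne j m with rfl | hj
        · rw [hb, zero_smul, zero_smul]
        · simp only [replacePoint_of_ne _ hj]
      -- coefficients which are zero are limits of nonzero ones along a line
      intro b x hb hx
      have h4 : ∀ b : ι → ℂ, b m = 0 → (∀ j ≠ m, b j ≠ 0) →
          eval (∑ j, b j • x j) (pderiv l F) = 0 := by
        intro b hb hb'
        have h5 := h3 b hb hb' l
        rw [← hPy, hη] at h5
        have h6 := h5 (Sum.elim (fun q => x q.1 q.2) 0) hx
        rwa [hPe] at h6
      let b' : ι → ℂ := fun j => if j = m then 0 else 1
      have h5 := restrictLine_eq_zero (∑ j, b j • x j) (∑ j, b' j • x j) (pderiv l F)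
        (E := Set.range fun j => -b j) (Set.finite_range _) fun ε hε => by
          rw [aeval_eq_eval_complex, ← h4 (b + ε • b')]
          · congr 2
            funext l
            simp [add_mul, Finset.sum_add_distrib, Finset.mul_sum, mul_assoc]
          · simp [hb, b']
          · intro j hj h0
            refine hε ⟨j, ?_⟩
            simp only [b', Pi.add_apply, Pi.smul_apply, if_neg hj, smul_eq_mul, mul_one] at h0
            linear_combination -h0
      have h6 := eval_restrictLine (∑ j, b j • x j) (∑ j, b' j • x j) (pderiv l F) 0
      rw [h5] at h6
      simp only [zero_mul, add_zero, Polynomial.eval_zero] at h6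
      exact h6.symm
    have hE := hF.sum_X_mul_pderiv
    simp only [hd, mul_zero, Finset.sum_const_zero] at hE
    exact (smul_eq_zero.1 hE.symm).resolve_left (Nat.succ_ne_zero d)

end Key

/-! ### Derivations along which a row space is constant -/

section NormalForm

variable {K : Type} [Field K] [Algebra ℂ K] (D : Derivation ℂ K K) {m : ℕ} {ρ : Type}

theorem Matrix.map_derivation_mul {a b c : Type*} [Fintype b] (g : Matrix a b K)
    (N : Matrix b c K) : (g * N).map D = g.map D * N + g * N.map D := by
  ext i l
  simp only [Matrix.map_apply, Matrix.mul_apply, Matrix.add_apply, map_sum, D.leibniz, smul_eq_mul,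
    Finset.sum_add_distrib]
  rw [add_comm]
  congr 1
  exact Finset.sum_congr rfl fun _ _ => mul_comm _ _

/-- A derivation which kills the normal form of a matrix preserves its row space. -/
theorem exists_map_derivation_eq_mul {M : Matrix (Fin m) ρ K} {s : Fin m → ρ} (hs : minors M s ≠ 0)
    (h : (normalForm M s).map D = 0) : ∃ B : Matrix (Fin m) (Fin m) K, M.map D = B * M := by
  refine ⟨(M.submatrix id s).map D * (M.submatrix id s)⁻¹, ?_⟩
  conv_lhs => rw [← submatrix_mul_normalForm hs, Matrix.map_derivation_mul, h, Matrix.mul_zero,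
    add_zero]
  rw [Matrix.mul_assoc]
  rfl

/-- A derivation which preserves the row space of a matrix kills its normal form. -/
theorem normalForm_map_derivation_eq_zero {M : Matrix (Fin m) ρ K} {s : Fin m → ρ}
    (hs : minors M s ≠ 0) {B : Matrix (Fin m) (Fin m) K} (h : M.map D = B * M) :
    (normalForm M s).map D = 0 := by
  have h1 : (M.submatrix id s).map D = B * M.submatrix id s := by
    ext i j
    have := congrFun (congrFun h i) (s j)
    simpa [Matrix.mul_apply] using this
  have h2 := Matrix.map_derivation_mul D (M.submatrix id s) (normalForm M s)
  rw [submatrix_mul_normalForm hs, h, h1, Matrix.mul_assoc, submatrix_mul_normalForm hs,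
    left_eq_add] at h2
  have h3 := congrArg (fun A => (M.submatrix id s)⁻¹ * A) h2
  simpa only [← Matrix.mul_assoc, Matrix.nonsing_inv_mul _ (isUnit_iff_ne_zero.2 hs),
    Matrix.one_mul, Matrix.mul_zero] using h3

end NormalForm

/-! ### General planes in general secant planes -/

section SecantMatrix

variable {m c : ℕ} {ρ : Type}

/-- The matrix with rows `p_i + ∑_j a_ij q_j`, where `p_i` and `q_j` are the points of a family and
`a_ij` its parameters. Its row space is the general `(m - 1)`-plane contained in the span of
the points, and the coefficients `(1 | a)` take away the choice of a basis of that plane. -/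
def secantMatrix {A : Type*} [CommRing A] (η : (Fin m ⊕ Fin c) × ρ ⊕ Fin m × Fin c → A) :
    Matrix (Fin m) ρ A :=
  fun i l => η (Sum.inl (Sum.inl i, l)) + ∑ j, η (Sum.inr (i, j)) * η (Sum.inl (Sum.inr j, l))

theorem linearIndependent_secantMatrix {F : Type*} [Field F]
    {η : (Fin m ⊕ Fin c) × ρ ⊕ Fin m × Fin c → F}
    (h : LinearIndependent F fun j l => η (Sum.inl (j, l))) :
    LinearIndependent F (secantMatrix η).row := by
  rw [Fintype.linearIndependent_iff] at h ⊢
  intro g hg i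
  refine h (Sum.elim g fun j => ∑ i, g i * η (Sum.inr (i, j))) ?_ (Sum.inl i)
  rw [← hg]
  funext l
  simp only [Finset.sum_apply, Fintype.sum_sum_type, Sum.elim_inl, Sum.elim_inr,
    Pi.smul_apply, smul_eq_mul, Matrix.row_apply, secantMatrix, mul_add, Finset.sum_add_distrib,
    Finset.sum_mul, Finset.mul_sum, mul_assoc]
  congr 1
  exact Finset.sum_comm

/-- The inclusion of the variables of a family with one point and one row of parameters less: those
with index `0` are left out. -/
def tailIndex : (Fin m ⊕ Fin c) × ρ ⊕ Fin m × Fin c →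
    (Fin (m + 1) ⊕ Fin c) × ρ ⊕ Fin (m + 1) × Fin c :=
  Sum.map (Prod.map (Sum.map Fin.succ id) id) (Prod.map Fin.succ id)

variable {K : Type} [Field K] [Algebra ℂ K]

theorem IsFieldGeneric.tail {S : Set (ρ → ℂ)} (hS : S.Nonempty)
    {η : (Fin (m + 1) ⊕ Fin c) × ρ ⊕ Fin (m + 1) × Fin c → K}
    (hη : IsFieldGeneric (pointFamilies (Fin (m + 1) ⊕ Fin c) (Fin (m + 1) × Fin c) S) η) :
    IsFieldGeneric (pointFamilies (Fin m ⊕ Fin c) (Fin m × Fin c) S) (η ∘ tailIndex) := by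
  obtain ⟨x, hx⟩ := hS
  refine hη.comp _ (fun y hy j => hy (Sum.map Fin.succ id j)) fun y' hy' => ?_
  refine ⟨Sum.elim (fun q => (Sum.elim (Fin.cons x fun i l => y' (Sum.inl (Sum.inl i, l)))
    (fun j l => y' (Sum.inl (Sum.inr j, l))) : Fin (m + 1) ⊕ Fin c → ρ → ℂ) q.1 q.2)
    (fun q => (Fin.cons 0 fun i j => y' (Sum.inr (i, j)) : Fin (m + 1) → Fin c → ℂ) q.1 q.2),
    ?_, ?_⟩
  · rintro (i | j)
    · refine Fin.cases ?_ (fun i => ?_) i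
      · exact hx
      · exact hy' (Sum.inl i)
    · exact hy' (Sum.inr j)
  · funext t
    rcases t with ⟨i | j, l⟩ | ⟨i, j⟩ <;> rfl

/-- If `D` preserves the row space of the secant matrix without being zero on its variables, and
no generic point lies in the span of the other ones and their derivatives, then the
same holds for the secant matrix without its first row. -/
theorem secantMatrix_tail_of_map_derivation_eq_mul
    {η : (Fin (m + 1) ⊕ Fin c) × ρ ⊕ Fin (m + 1) × Fin c → K} {l₀ : ρ}
    (h₀ : η (Sum.inl (Sum.inl 0, l₀)) = 1) (D : Derivation ℂ K K)
    (hspan : ∀ j₀, (fun l => η (Sum.inl (j₀, l))) ∉ Submodule.span K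
      {w : ρ → K | ∃ j ≠ j₀, w = (fun l => η (Sum.inl (j, l))) ∨
        w = fun l => D (η (Sum.inl (j, l)))})
    {B : Matrix (Fin (m + 1)) (Fin (m + 1)) K}
    (hB : (secantMatrix η).map D = B * secantMatrix η) (hD : ∃ t, D (η t) ≠ 0) :
    (∃ B' : Matrix (Fin m) (Fin m) K, (secantMatrix (η ∘ tailIndex)).map D =
      B' * secantMatrix (η ∘ tailIndex)) ∧ ∃ t, D (η (tailIndex t)) ≠ 0 := by
  let M := secantMatrix η
  let p : Fin (m + 1) ⊕ Fin c → ρ → K := fun j l => η (Sum.inl (j, l))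
  let p' : Fin (m + 1) ⊕ Fin c → ρ → K := fun j l => D (η (Sum.inl (j, l)))
  let a : Fin (m + 1) → Fin c → K := fun i j => η (Sum.inr (i, j))
  have hM : ∀ i, M i = p (Sum.inl i) + ∑ j, a i j • p (Sum.inr j) := by
    intro i; funext l
    simp [M, secantMatrix, p, a]
  have hDM : ∀ i, p' (Sum.inl i) + ∑ j, (a i j • p' (Sum.inr j) + D (a i j) • p (Sum.inr j)) =
      ∑ i', B i i' • M i' := by
    intro i; funext l
    have h1 := congrFun (congrFun hB i) l
    rw [Matrix.map_apply, Matrix.mul_apply] at h1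
    simp only [Pi.add_apply, Finset.sum_apply, Pi.smul_apply, smul_eq_mul]
    rw [← h1, secantMatrix, map_add, map_sum]
    congr 1
    refine Finset.sum_congr rfl fun j _ => ?_
    rw [D.leibniz]
    simp only [p, p', a, smul_eq_mul]
    ring
  -- membership in the span of the points other than a given one and their derivatives
  have hp : ∀ {j₀ j}, j ≠ j₀ → p j ∈ Submodule.span K
      {w : ρ → K | ∃ j ≠ j₀, w = (fun l => η (Sum.inl (j, l))) ∨
        w = fun l => D (η (Sum.inl (j, l)))} := fun {j₀ j} hj =>
    Submodule.subset_span ⟨j, hj, Or.inl rfl⟩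
  have hp' : ∀ {j₀ j}, j ≠ j₀ → p' j ∈ Submodule.span K
      {w : ρ → K | ∃ j ≠ j₀, w = (fun l => η (Sum.inl (j, l))) ∨
        w = fun l => D (η (Sum.inl (j, l)))} := fun {j₀ j} hj =>
    Submodule.subset_span ⟨j, hj, Or.inr rfl⟩
  have hB0 : ∀ i : Fin m, B i.succ 0 = 0 := by
    intro i
    by_contra hne
    refine hspan (Sum.inl 0) ?_
    set V := Submodule.span K {w : ρ → K | ∃ j ≠ (Sum.inl 0 : Fin (m + 1) ⊕ Fin c),
      w = (fun l => η (Sum.inl (j, l))) ∨ w = fun l => D (η (Sum.inl (j, l)))}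
    have hMs : ∀ i : Fin m, M i.succ ∈ V := by
      intro i
      rw [hM]
      exact V.add_mem (hp (by simp [Fin.succ_ne_zero])) (V.sum_mem fun j _ =>
        V.smul_mem _ (hp (by simp)))
    have h1 : B i.succ 0 • M 0 ∈ V := by
      have h2 := hDM i.succ
      rw [Fin.sum_univ_succ] at h2
      rw [← sub_eq_iff_eq_add.2 h2]
      refine V.sub_mem (V.add_mem (hp' (by simp [Fin.succ_ne_zero])) (V.sum_mem fun j _ =>
        V.add_mem (V.smul_mem _ (hp' (by simp))) (V.smul_mem _ (hp (by simp))))) ?_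
      exact V.sum_mem fun i' _ => V.smul_mem _ (hMs i')
    have h2 : M 0 ∈ V := (V.smul_mem_iff hne).1 h1
    rw [hM] at h2
    exact (V.add_mem_iff_left (V.sum_mem fun j _ => V.smul_mem _ (hp (by simp)))).1 h2
  refine ⟨⟨B.submatrix Fin.succ Fin.succ, ?_⟩, ?_⟩
  · ext i l
    have h1 := congrFun (congrFun hB i.succ) l
    rw [Matrix.mul_apply, Fin.sum_univ_succ, hB0, zero_mul, zero_add] at h1
    rw [Matrix.mul_apply]
    exact h1
  · by_contra hcon
    push Not at hcon
    have hp0 : ∀ j ≠ (Sum.inl 0 : Fin (m + 1) ⊕ Fin c), p' j = 0 := by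
      rintro (i | j) hne
      · obtain ⟨i, rfl⟩ := Fin.exists_succ_eq.2 (fun h : i = 0 => hne (by rw [h]))
        funext l
        exact hcon (Sum.inl (Sum.inl i, l))
      · funext l
        exact hcon (Sum.inl (Sum.inr j, l))
    have ha0 : ∀ i j, D (a (Fin.succ i) j) = 0 := fun i j => hcon (Sum.inr (i, j))
    -- the derivative of the point with index `0` as a combination of all points
    let β : Fin (m + 1) ⊕ Fin c → K :=
      Sum.elim (B 0) fun j => ∑ i, B 0 i * a i j - D (a 0 j)
    have hβ : p' (Sum.inl 0) = ∑ j, β j • p j := by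
      have h1 := hDM 0
      have h2 : ∀ j, a 0 j • p' (Sum.inr j) + D (a 0 j) • p (Sum.inr j) =
          D (a 0 j) • p (Sum.inr j) := fun j => by
        rw [hp0 _ (by simp), smul_zero, zero_add]
      simp only [h2, hM] at h1
      rw [eq_sub_of_add_eq h1]
      simp only [β, Fintype.sum_sum_type, Sum.elim_inl, Sum.elim_inr, smul_add,
        Finset.sum_add_distrib, sub_smul, Finset.sum_sub_distrib, Finset.smul_sum, smul_smul,
        Finset.sum_smul]
      rw [Finset.sum_comm, add_sub_assoc]
    have hβ0 : ∀ j ≠ (Sum.inl 0 : Fin (m + 1) ⊕ Fin c), β j = 0 := by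
      intro j₀ hj₀
      by_contra hne
      refine hspan j₀ ?_
      set V := Submodule.span K {w : ρ → K | ∃ j ≠ j₀,
        w = (fun l => η (Sum.inl (j, l))) ∨ w = fun l => D (η (Sum.inl (j, l)))}
      rw [← Finset.add_sum_erase _ _ (Finset.mem_univ j₀)] at hβ
      have h1 : β j₀ • p j₀ ∈ V := by
        rw [eq_sub_of_add_eq hβ.symm]
        exact V.sub_mem (hp' hj₀.symm) (V.sum_mem fun j hj =>
          V.smul_mem _ (hp (Finset.ne_of_mem_erase hj)))
      exact (V.smul_mem_iff hne).1 h1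
    have h1 : p' (Sum.inl 0) = β (Sum.inl 0) • p (Sum.inl 0) := by
      rw [hβ, Finset.sum_eq_single (Sum.inl 0)]
      · intro j _ hj
        rw [hβ0 j hj, zero_smul]
      · simp
    have hβ00 : β (Sum.inl 0) = 0 := by
      have h2 := congrFun h1 l₀
      simp only [p, p', Pi.smul_apply, smul_eq_mul, h₀, mul_one, D.map_one_eq_zero] at h2
      exact h2.symm
    have hp00 : p' (Sum.inl 0) = 0 := by rw [h1, hβ00, zero_smul]
    have hB00 : ∀ i, B 0 i = 0 := by
      intro i
      rcases eq_or_ne i 0 with rfl | hi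
      · exact hβ00
      · exact hβ0 (Sum.inl i) (by simpa using hi)
    have ha00 : ∀ j, D (a 0 j) = 0 := by
      intro j
      have h2 := hβ0 (Sum.inr j) (by simp)
      simpa [β, hB00] using h2
    obtain ⟨t, ht⟩ := hD
    refine ht ?_
    rcases t with ⟨j, l⟩ | ⟨i, j⟩
    · rcases eq_or_ne j (Sum.inl 0) with rfl | hj
      · exact congrFun hp00 l
      · exact congrFun (hp0 j hj) l
    · rcases Fin.eq_zero_or_eq_succ i with rfl | ⟨i, rfl⟩
      · exact ha00 j
      · exact ha0 i j

end SecantMatrix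

/-! ### The defect passes to smaller secant planes -/

section Defect

variable {m c : ℕ} {ρ K : Type} [Field K] [Algebra ℂ K]

theorem normalForm_secantMatrix_mem_adjoin (η : (Fin m ⊕ Fin c) × ρ ⊕ Fin m × Fin c → K)
    (s : Fin m → ρ) (i : Fin m) (l : ρ) :
    normalForm (secantMatrix η) s i l ∈ IntermediateField.adjoin ℂ (Set.range η) := by
  have hM : ∀ i l, secantMatrix η i l ∈ IntermediateField.adjoin ℂ (Set.range η) := fun i l =>
    add_mem (IntermediateField.subset_adjoin _ _ ⟨_, rfl⟩) (sum_mem fun j _ =>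
      mul_mem (IntermediateField.subset_adjoin _ _ ⟨_, rfl⟩)
        (IntermediateField.subset_adjoin _ _ ⟨_, rfl⟩))
  let M' : Matrix (Fin m) ρ (IntermediateField.adjoin ℂ (Set.range η)) := fun i l => ⟨_, hM i l⟩
  have h : normalForm (secantMatrix η) s =
      (normalForm M' s).map (algebraMap (IntermediateField.adjoin ℂ (Set.range η)) K) := by
    rw [normalForm, normalForm, Matrix.map_mul, Matrix.inv_def, Matrix.inv_def]
    congr 1
    ext i j
    have h1 : (secantMatrix η).submatrix id s = (M'.submatrix id s).map
        (algebraMap (IntermediateField.adjoin ℂ (Set.range η)) K) := rfl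
    rw [h1, ← RingHom.mapMatrix_apply, ← RingHom.map_det, ← RingHom.map_adjugate]
    simp
  rw [h]
  exact (normalForm M' s i l).2

/-- If the coordinates of the general plane contained in the general secant plane have smaller
transcendence degree than the points and parameters it is made of, then the same holds with one
point less. -/
theorem eRk_normalForm_tail_lt [Fintype ρ] {S : Set (ρ → ℂ)} (hS : IsIrreducibleSet S)
    (hspan : ∀ c : ρ → ℂ, (∀ x ∈ S, ∑ l, c l * x l = 0) → c = 0) {l₀ : ρ}
    (hl₀ : ∀ x ∈ S, x l₀ = 1) {F : MvPolynomial ρ ℂ} {d : ℕ} (hF : F.IsHomogeneous d)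
    (hF0 : F ≠ 0)
    (hFS : ∀ (j₀ : Fin (m + 1) ⊕ Fin c) (b : Fin (m + 1) ⊕ Fin c → ℂ)
      (x : Fin (m + 1) ⊕ Fin c → ρ → ℂ), b j₀ = 0 → (∀ j, x j ∈ S) → eval (∑ j, b j • x j) F = 0)
    {η : (Fin (m + 1) ⊕ Fin c) × ρ ⊕ Fin (m + 1) × Fin c → K}
    (hη : IsFieldGeneric (pointFamilies (Fin (m + 1) ⊕ Fin c) (Fin (m + 1) × Fin c) S) η)
    {s : Fin (m + 1) → ρ} (hs : minors (secantMatrix η) s ≠ 0)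
    {s' : Fin m → ρ} (hs' : minors (secantMatrix (η ∘ tailIndex)) s' ≠ 0)
    (hlt : (algMatroid K).eRk (Set.range fun p : Fin (m + 1) × ρ =>
      normalForm (secantMatrix η) s p.1 p.2) < (algMatroid K).eRk (Set.range η)) :
    (algMatroid K).eRk (Set.range fun p : Fin m × ρ =>
      normalForm (secantMatrix (η ∘ tailIndex)) s' p.1 p.2) <
      (algMatroid K).eRk (Set.range (η ∘ tailIndex)) := by
  -- a derivation along which the plane does not move, but the secant plane or its points do
  obtain ⟨t, ht⟩ : ∃ t, η t ∉ (algMatroid K).closure (Set.range fun p : Fin (m + 1) × ρ =>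
      normalForm (secantMatrix η) s p.1 p.2) := by
    by_contra hcon
    push Not at hcon
    refine hlt.not_ge ?_
    rw [← Matroid.eRk_closure_eq _ (Set.range fun p : Fin (m + 1) × ρ => _)]
    exact Matroid.eRk_mono _ (Set.range_subset_iff.2 hcon)
  obtain ⟨D, hD, hDt⟩ := exists_derivation_ne_zero ht
  obtain ⟨B, hB⟩ := exists_map_derivation_eq_mul D hs (by
    ext i l; exact hD _ ⟨(i, l), rfl⟩)
  have h₀ : η (Sum.inl (Sum.inl 0, l₀)) = 1 := by
    have h1 := (hη (X (Sum.inl (Sum.inl 0, l₀)) - 1)).2 fun y hy => by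
      have := hl₀ _ (hy (Sum.inl 0))
      simp [this]
    simpa [sub_eq_zero] using h1
  obtain ⟨⟨B', hB'⟩, t', ht'⟩ := secantMatrix_tail_of_map_derivation_eq_mul h₀ D
    (fun j₀ hj₀ => hF0 (eq_zero_of_mem_span_tangent hη hS hspan j₀ D hj₀ d F hF (hFS j₀))) hB
    ⟨t, hDt⟩
  have hN := normalForm_map_derivation_eq_zero D hs' hB'
  -- the derivation shows that the smaller plane does not determine its secant plane either
  by_contra hcon
  refine ht' (Derivation.eqOn_zero_closure (D := D) (S := Set.range fun p : Fin m × ρ =>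
      normalForm (secantMatrix (η ∘ tailIndex)) s' p.1 p.2) ?_ ?_)
  · rintro _ ⟨⟨i, l⟩, rfl⟩
    exact congrFun (congrFun hN i) l
  · rw [((algMatroid K).isRkFinite_of_finite
      (Set.finite_range _)).closure_eq_closure_of_subset_of_eRk_ge_eRk
      (Y := (algMatroid K).closure (Set.range (η ∘ tailIndex))) ?_ ?_]
    · exact (algMatroid K).subset_closure _ (Set.subset_univ _)
        ((algMatroid K).subset_closure _ (Set.subset_univ _) ⟨t', rfl⟩)
    · rintro _ ⟨⟨i, l⟩, rfl⟩
      exact adjoin_subset_algMatroid_closure _ (normalForm_secantMatrix_mem_adjoin _ _ _ _)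
    · rw [Matroid.eRk_closure_eq]
      exact not_lt.1 hcon

end Defect

/-! ### Independent points of a nondegenerate set -/

section Independent

variable {ι κ ρ : Type} [Fintype ι] [Fintype ρ] {S : Set (ρ → ℂ)}

theorem span_eq_top_of_forall_sum_mul_eq_zero
    (hspan : ∀ c : ρ → ℂ, (∀ x ∈ S, ∑ l, c l * x l = 0) → c = 0) :
    Submodule.span ℂ S = ⊤ := by
  classical
  by_contra hne
  obtain ⟨f, hf0, hf⟩ := Submodule.exists_le_ker_of_lt_top _ (lt_top_iff_ne_top.2 hne)
  have hfx : ∀ x, f x = ∑ l, f (Pi.single l 1) * x l := fun x => by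
    conv_lhs => rw [pi_eq_sum_univ' x, map_sum]
    refine Finset.sum_congr rfl fun l _ => ?_
    rw [map_smul, smul_eq_mul, mul_comm]
  refine hf0 ?_
  have h0 := hspan (fun l => f (Pi.single l 1)) fun x hx => by
    rw [← hfx]; exact hf (Submodule.subset_span hx)
  refine LinearMap.ext fun x => ?_
  rw [hfx, LinearMap.zero_apply]
  exact Finset.sum_eq_zero fun l _ => by
    rw [show f (Pi.single l 1) = 0 from congrFun h0 l, zero_mul]

theorem exists_linearIndependent_of_span_eq_top (h : Submodule.span ℂ S = ⊤)
    (hc : Fintype.card ι ≤ Fintype.card ρ) :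
    ∃ x : ι → ρ → ℂ, (∀ j, x j ∈ S) ∧ LinearIndependent ℂ x := by
  let b := Module.Basis.ofSpan h.ge
  have := FiniteDimensional.fintypeBasisIndex b
  have hcard := Module.finrank_eq_card_basis b
  rw [Module.finrank_fintype_fun_eq_card] at hcard
  obtain ⟨e⟩ := Function.Embedding.nonempty_of_card_le (hc.trans hcard.le)
  exact ⟨fun j => b (e j), fun j => Module.Basis.ofSpan_subset h.ge ⟨_, rfl⟩,
    b.linearIndependent.comp e e.injective⟩

/-- The points of a family are linearly independent unless certain polynomials vanish. -/
theorem exists_eval_ne_zero_of_linearIndependent {y : ι × ρ ⊕ κ → ℂ}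
    (hy : LinearIndependent ℂ fun j l => y (Sum.inl (j, l))) :
    ∃ g : MvPolynomial (ι × ρ ⊕ κ) ℂ, eval y g ≠ 0 ∧
      ∀ {K : Type} [Field K] [Algebra ℂ K] (z : ι × ρ ⊕ κ → K), aeval z g ≠ 0 →
        LinearIndependent K fun j l => z (Sum.inl (j, l)) := by
  let e := (Fintype.equivFin ι).symm
  let M : Matrix (Fin (Fintype.card ι)) ρ (MvPolynomial (ι × ρ ⊕ κ) ℂ) :=
    fun i l => X (Sum.inl (e i, l))
  have hM : ∀ {K : Type} [Field K] [Algebra ℂ K] (z : ι × ρ ⊕ κ → K) s,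
      aeval z (minors M s) = minors (fun i l => z (Sum.inl (e i, l))) s := by
    intro K _ _ z s
    have h := map_minors ((aeval z : MvPolynomial (ι × ρ ⊕ κ) ℂ →ₐ[ℂ] K) : _ →+* K) M s
    refine h.trans ?_
    congr 1
    ext i l
    exact aeval_X z _
  obtain ⟨s, hs⟩ := exists_minors_ne_zero
    (v := fun (i : Fin (Fintype.card ι)) l => y (Sum.inl (e i, l))) (hy.comp e e.injective)
  refine ⟨minors M s, ?_, fun {K} _ _ z hz => ?_⟩
  · rw [← aeval_eq_eval_complex, hM]
    exact hs
  · rw [hM] at hz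
    have h := linearIndependent_row_of_minors_ne_zero hz
    exact (linearIndependent_equiv e).1 h

/-- A polynomial which vanishes at all linearly independent families of points of an irreducible
nondegenerate set vanishes at all families. -/
theorem eval_eq_zero_of_linearIndependent (hS : IsIrreducibleSet S)
    (hspan : Submodule.span ℂ S = ⊤) (hc : Fintype.card ι ≤ Fintype.card ρ)
    {f : MvPolynomial (ι × ρ ⊕ κ) ℂ}
    (hf : ∀ y ∈ pointFamilies ι κ S, LinearIndependent ℂ (fun j l => y (Sum.inl (j, l))) →
      eval y f = 0) {y : ι × ρ ⊕ κ → ℂ} (hy : y ∈ pointFamilies ι κ S) : eval y f = 0 := by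
  by_contra hne
  obtain ⟨x, hx, hxi⟩ := exists_linearIndependent_of_span_eq_top hspan hc
  obtain ⟨g, hg, hgi⟩ := exists_eval_ne_zero_of_linearIndependent (κ := κ)
    (y := Sum.elim (fun q => x q.1 q.2) 0) hxi
  obtain ⟨z, hz, hzf, hzg⟩ := hS.pointFamilies.exists_ne_zero f g ⟨y, hy, hne⟩
    ⟨Sum.elim (fun q => x q.1 q.2) 0, hx, hg⟩
  exact hzf (hf z hz (hgi z (by rwa [aeval_eq_eval_complex])))

theorem IsFieldGeneric.linearIndependent {K : Type} [Field K] [Algebra ℂ K] {η : ι × ρ ⊕ κ → K}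
    (hη : IsFieldGeneric (pointFamilies ι κ S) η)
    (hspan : Submodule.span ℂ S = ⊤) (hc : Fintype.card ι ≤ Fintype.card ρ) :
    LinearIndependent K fun j l => η (Sum.inl (j, l)) := by
  obtain ⟨x, hx, hxi⟩ := exists_linearIndependent_of_span_eq_top hspan hc
  obtain ⟨g, hg, hgi⟩ := exists_eval_ne_zero_of_linearIndependent (κ := κ)
    (y := Sum.elim (fun q => x q.1 q.2) 0) hxi
  refine hgi η fun h => hg ?_
  exact (hη g).1 h _ hx

end Independent

/-! ### Affine charts of a nondegenerate variety -/

section Variety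

variable {r n : ℕ} {X : Set (ProjSpace r)} {s₀ : Fin (r + 1)}

theorem exists_affinePart_nonempty (hX : X.Nonempty) : ∃ s₀, (affinePart s₀ X).Nonempty := by
  obtain ⟨p, hp⟩ := hX
  obtain ⟨s, hs⟩ : ∃ s, p.rep s ≠ 0 := Function.ne_iff.1 p.rep_nonzero
  exact ⟨s, _, smul_rep_mem_affinePart hp hs⟩

theorem isIrreducibleSet_affinePart (hX : IsPreirreducible X) (hne : (affinePart s₀ X).Nonempty) :
    IsIrreducibleSet (affinePart s₀ X) :=
  ⟨hne, fun _ _ hf hg => exists_mem_affinePart_ne_zero hX hf hg⟩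

theorem mem_submodule_iff_exists_smul_rep {p : ProjSpace r} {v : Fin (r + 1) → ℂ} :
    v ∈ p.submodule ↔ ∃ a : ℂ, a • p.rep = v := by
  rw [Projectivization.submodule_eq, Submodule.mem_span_singleton]

theorem rep_mem_submodule (p : ProjSpace r) : p.rep ∈ p.submodule :=
  mem_submodule_iff_exists_smul_rep.2 ⟨1, one_smul _ _⟩

theorem mk_submodule {x : Fin (r + 1) → ℂ} (hx : x ≠ 0) :
    (Projectivization.mk ℂ x hx).submodule = Submodule.span ℂ {x} := by
  rw [Projectivization.submodule_mk]

theorem IsNondegenerateVariety.eq_zero_of_sum_mul_eq_zero (hX : IsNondegenerateVariety n X)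
    (hne : (affinePart s₀ X).Nonempty) (c : Fin (r + 1) → ℂ)
    (hc : ∀ x ∈ affinePart s₀ X, ∑ l, c l * x l = 0) : c = 0 := by
  have hF : (∑ l, C (c l) * MvPolynomial.X l : MvPolynomial (Fin (r + 1)) ℂ).IsHomogeneous 1 :=
    IsHomogeneous.sum _ _ _ fun l _ => isHomogeneous_C_mul_X _ _
  let f : (Fin (r + 1) → ℂ) →ₗ[ℂ] ℂ := ∑ l, c l • LinearMap.proj l
  have hf : ∀ x, f x = ∑ l, c l * x l := fun x => by simp [f]
  have h1 : (⊤ : Submodule ℂ (Fin (r + 1) → ℂ)) ≤ LinearMap.ker f := by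
    rw [← hX.nondegenerate]
    refine iSup₂_le fun p hp v hv => ?_
    obtain ⟨a, rfl⟩ := mem_submodule_iff_exists_smul_rep.1 hv
    have h2 := eval_rep_eq_zero_of_affinePart hX.isIrreducible.isPreirreducible hne hF
      (fun x hx => by simpa using hc x hx) hp
    rw [LinearMap.mem_ker, map_smul, hf]
    simp only [map_sum, map_mul, eval_C, eval_X] at h2
    rw [h2, smul_zero]
  funext l
  have h3 : f (Pi.single l 1) = 0 := h1 trivial
  rw [hf] at h3
  simpa [Pi.single_apply] using h3

theorem IsNondegenerateVariety.eRk_eq (hX : IsNondegenerateVariety n X)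
    (hne : (affinePart s₀ X).Nonempty) {K : Type} [Field K] [Algebra ℂ K] {ξ : Fin (r + 1) → K}
    (hξ : IsFieldGeneric (affinePart s₀ X) ξ) : (algMatroid K).eRk (Set.range ξ) = n := by
  have hs : ξ s₀ = 1 := by
    have h1 := (hξ (MvPolynomial.X s₀ - 1)).2 fun y hy => by simp [hy.1]
    simpa [sub_eq_zero] using h1
  have h1 : ((algMatroid K).eRk (Set.range ξ) : WithBot ℕ∞) ≤ topologicalKrullDim X :=
    eRk_le_topologicalKrullDim hX.isClosed ξ hs fun F d hF h => (hξ F).2 fun y hy => by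
      have hy0 := ne_zero_of_mem_affinePart hy
      exact (eval_rep_mk_eq_zero_iff hF hy0).1 (h _ (hy.2 hy0))
  have h2 : topologicalKrullDim X ≤ ((algMatroid K).eRk (Set.range ξ) : WithBot ℕ∞) :=
    topologicalKrullDim_le_of_generic X ξ (fun F d hF h p hp =>
      eval_rep_eq_zero_of_affinePart hX.isIrreducible.isPreirreducible hne hF ((hξ F).1 h) hp) _
      fun s _ => eRk_le_of_subset_adjoin (by
        rintro _ ⟨l, rfl⟩
        exact mul_mem (inv_mem (IntermediateField.subset_adjoin _ _ ⟨s, rfl⟩))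
          (IntermediateField.subset_adjoin _ _ ⟨l, rfl⟩))
  have h3 := le_antisymm h1 h2
  rw [hX.dim_eq] at h3
  exact_mod_cast h3

/-- A polynomial which vanishes on the cone over an affine chart of an irreducible set vanishes on
the cone over the set. -/
theorem eval_rep_eq_zero_of_forall_smul (hX : IsPreirreducible X)
    (hne : (affinePart s₀ X).Nonempty) {F : MvPolynomial (Fin (r + 1)) ℂ}
    (h : ∀ x ∈ affinePart s₀ X, ∀ t : ℂ, eval (t • x) F = 0) {p : ProjSpace r} (hp : p ∈ X) :
    eval p.rep F = 0 := by
  rw [← sum_homogeneousComponent F, map_sum]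
  refine Finset.sum_eq_zero fun d hd => ?_
  refine eval_rep_eq_zero_of_affinePart hX hne (homogeneousComponent_isHomogeneous d F) ?_ hp
  intro x hx
  let f : Polynomial ℂ := ∑ i ∈ Finset.range (F.totalDegree + 1),
    Polynomial.C (eval x (homogeneousComponent i F)) * Polynomial.X ^ i
  have hf : f = 0 := by
    refine Polynomial.funext fun t => ?_
    have h1 := h x hx t
    rw [← sum_homogeneousComponent F, map_sum] at h1
    rw [Polynomial.eval_zero, ← h1, Polynomial.eval_finsetSum]
    refine Finset.sum_congr rfl fun i _ => ?_
    rw [eval_smul_of_isHomogeneous (homogeneousComponent_isHomogeneous i F)]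
    rw [Polynomial.eval_C_mul, Polynomial.eval_X_pow, mul_comm]
  have h2 := congrArg (fun g => Polynomial.coeff g d) hf
  simp only [f, Polynomial.finsetSum_coeff, Polynomial.coeff_C_mul, Polynomial.coeff_X_pow,
    mul_ite, mul_one, mul_zero, Finset.sum_ite_eq, Polynomial.coeff_zero, if_pos hd] at h2
  exact h2

end Variety

/-! ### Equations of the planes contained in secant planes -/

theorem aeval_evalMatrix {τ A : Type*} [CommRing A] [Algebra ℂ A] {m n : ℕ}
    (V : Fin m → Fin n → MvPolynomial τ ℂ) (Ψ : MvPolynomial (Fin m × Fin n) ℂ) (z : τ → A) :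
    aeval z (evalMatrix V Ψ) = evalMatrix (fun i l => aeval z (V i l)) Ψ := by
  rw [evalMatrix, ← AlgHom.comp_apply, evalMatrix]
  congr 1
  ext p
  simp

section Equations

variable {m c r k : ℕ} {X : Set (ProjSpace r)} {s₀ : Fin (r + 1)}

/-- The equation `Ψ` of the rows of a secant matrix, in terms of the points and the parameters. -/
noncomputable def secantEquation (c : ℕ) (Ψ : MvPolynomial (Fin m × Fin (r + 1)) ℂ) :
    MvPolynomial ((Fin m ⊕ Fin c) × Fin (r + 1) ⊕ Fin m × Fin c) ℂ :=
  evalMatrix (secantMatrix MvPolynomial.X) Ψ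

theorem aeval_secantEquation {A : Type*} [CommRing A] [Algebra ℂ A]
    (Ψ : MvPolynomial (Fin m × Fin (r + 1)) ℂ)
    (z : (Fin m ⊕ Fin c) × Fin (r + 1) ⊕ Fin m × Fin c → A) :
    aeval z (secantEquation c Ψ) = evalMatrix (secantMatrix z) Ψ := by
  refine (aeval_evalMatrix _ _ _).trans ?_
  congr 1
  funext i l
  simp [secantMatrix]

theorem IsFieldGeneric.evalMatrix_secantMatrix_eq_zero_iff {K : Type} [Field K] [Algebra ℂ K]
    {S : Set (Fin (r + 1) → ℂ)} {η : (Fin m ⊕ Fin c) × Fin (r + 1) ⊕ Fin m × Fin c → K}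
    (hη : IsFieldGeneric (pointFamilies (Fin m ⊕ Fin c) (Fin m × Fin c) S) η)
    (Ψ : MvPolynomial (Fin m × Fin (r + 1)) ℂ) :
    evalMatrix (secantMatrix η) Ψ = 0 ↔
      ∀ y ∈ pointFamilies (Fin m ⊕ Fin c) (Fin m × Fin c) S, evalMatrix (secantMatrix y) Ψ = 0 := by
  rw [← aeval_secantEquation, hη]
  simp only [← aeval_secantEquation, aeval_eq_eval_complex]

/-- An equation which depends only on the row space of a matrix, up to factors, and which
holds for the matrices with left block `1`, holds for all matrices. -/
theorem evalMatrix_mul_eq_zero {S : Set (Fin (r + 1) → ℂ)}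
    {Ψ : MvPolynomial (Fin m × Fin (r + 1)) ℂ} {e : ℕ}
    (hg : ∀ (g : Matrix (Fin m) (Fin m) ℂ) (v : Matrix (Fin m) (Fin (r + 1)) ℂ),
      evalMatrix (g * v) Ψ = g.det ^ e * evalMatrix v Ψ)
    (h : ∀ y ∈ pointFamilies (Fin m ⊕ Fin c) (Fin m × Fin c) S, evalMatrix (secantMatrix y) Ψ = 0)
    (A : Matrix (Fin m) (Fin m ⊕ Fin c) ℂ) {x : Matrix (Fin m ⊕ Fin c) (Fin (r + 1)) ℂ}
    (hx : ∀ j, x j ∈ S) : evalMatrix (A * x) Ψ = 0 := by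
  let A₁ : Matrix (Fin m) (Fin m) ℂ := A.submatrix id Sum.inl
  let A₂ : Matrix (Fin m) (Fin c) ℂ := A.submatrix id Sum.inr
  let x₁ : Matrix (Fin m) (Fin (r + 1)) ℂ := x.submatrix Sum.inl id
  let x₂ : Matrix (Fin c) (Fin (r + 1)) ℂ := x.submatrix Sum.inr id
  have hAx : A * x = A₁ * x₁ + A₂ * x₂ := by
    ext i l
    simp [A₁, A₂, x₁, x₂, Matrix.mul_apply, Matrix.add_apply]
  have key : ∀ B : Matrix (Fin m) (Fin m) ℂ, B.det ≠ 0 → evalMatrix (B * x₁ + A₂ * x₂) Ψ = 0 := by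
    intro B hB
    have h1 : B * x₁ + A₂ * x₂ = B * secantMatrix
        (Sum.elim (fun q => x q.1 q.2) fun q => (B⁻¹ * A₂) q.1 q.2) := by
      have h2 : secantMatrix (Sum.elim (fun q => x q.1 q.2) fun q => (B⁻¹ * A₂) q.1 q.2) =
          x₁ + B⁻¹ * A₂ * x₂ := by
        ext i l
        simp [secantMatrix, x₁, x₂, Matrix.mul_apply, Matrix.add_apply]
      rw [h2, Matrix.mul_add, ← Matrix.mul_assoc, ← Matrix.mul_assoc,
        Matrix.mul_nonsing_inv _ (isUnit_iff_ne_zero.2 hB), Matrix.one_mul]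
    rw [h1, hg, h (Sum.elim (fun q => x q.1 q.2) fun q => (B⁻¹ * A₂) q.1 q.2) hx, mul_zero]
  -- perturb the left block by multiples of the identity matrix
  have h1 := restrictLine_eq_zero (fun p : Fin m × Fin (r + 1) => (A * x) p.1 p.2)
    (fun p => x₁ p.1 p.2) Ψ (Polynomial.finite_setOfPred_isRoot (-A₁).charpoly_monic.ne_zero)
    fun ε hε => by
      rw [Set.mem_ofPred_eq, Polynomial.IsRoot, Matrix.eval_charpoly, sub_neg_eq_add] at hε
      refine Eq.trans ?_ (key _ hε)
      refine congrArg (fun w => aeval w Ψ) ?_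
      funext p
      rw [hAx, Matrix.add_mul, add_assoc, add_comm]
      simp [Matrix.add_apply]
  have h2 := eval_restrictLine (fun p : Fin m × Fin (r + 1) => (A * x) p.1 p.2)
    (fun p => x₁ p.1 p.2) Ψ 0
  rw [h1] at h2
  simp only [zero_mul, add_zero, Polynomial.eval_zero] at h2
  exact h2.symm

/-- The points of the affine chart may be replaced by arbitrary points of the variety. -/
theorem evalMatrix_mul_rep_eq_zero (hX : IsPreirreducible X) (hne : (affinePart s₀ X).Nonempty)
    {J : Type} [Fintype J] [DecidableEq J]
    {Ψ : MvPolynomial (Fin m × Fin (r + 1)) ℂ}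
    (h : ∀ (A : Matrix (Fin m) J ℂ) (x : Matrix J (Fin (r + 1)) ℂ),
      (∀ j, x j ∈ affinePart s₀ X) → evalMatrix (A * x) Ψ = 0)
    (A : Matrix (Fin m) J ℂ) (q : J → ProjSpace r) (hq : ∀ j, q j ∈ X) :
    evalMatrix (A * Matrix.of fun j => (q j).rep) Ψ = 0 := by
  have key : ∀ (I : Finset J) (A : Matrix (Fin m) J ℂ) (x : Matrix J (Fin (r + 1)) ℂ),
      (∀ j, x j ∈ affinePart s₀ X ∨ j ∈ I ∧ ∃ p ∈ X, x j = p.rep) → evalMatrix (A * x) Ψ = 0 := by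
    intro I
    induction I using Finset.induction_on with
    | empty => exact fun A x hx => h A x fun j => by simpa using hx j
    | insert i I hi ih =>
      intro A x hx
      by_cases hxi : x i ∈ affinePart s₀ X
      · refine ih A x fun j => ?_
        rcases eq_or_ne j i with rfl | hj
        · exact Or.inl hxi
        · simpa [hj] using hx j
      obtain ⟨p, hp, hxp⟩ := ((hx i).resolve_left hxi).2
      let G : MvPolynomial (Fin (r + 1)) ℂ := evalMatrix
        (fun a l => ∑ j, C (A a j) * (if j = i then MvPolynomial.X l else C (x j l))) Ψ
      have hG : ∀ z, eval z G = evalMatrix (A * x.updateRow i z) Ψ := by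
        intro z
        rw [← aeval_eq_eval_complex, aeval_evalMatrix]
        congr 1
        funext a l
        rw [map_sum, Matrix.mul_apply]
        refine Finset.sum_congr rfl fun j _ => ?_
        rcases eq_or_ne j i with rfl | hj
        · simp
        · simp [hj]
      have h1 := eval_rep_eq_zero_of_forall_smul hX hne (F := G) (fun z hz t => by
        have h2 : A * x.updateRow i (t • z) =
            A.updateCol i (fun a => A a i * t) * x.updateRow i z := by
          ext a l
          rw [Matrix.mul_apply, Matrix.mul_apply]
          refine Finset.sum_congr rfl fun j _ => ?_
          rcases eq_or_ne j i with rfl | hj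
          · simp [mul_assoc]
          · simp [hj]
        rw [hG, h2]
        refine ih _ _ fun j => ?_
        rcases eq_or_ne j i with rfl | hj
        · left; simpa using hz
        · have := hx j
          simp only [Finset.mem_insert, hj, false_or] at this
          simpa [Matrix.updateRow_ne hj] using this) hp
      rw [hG, ← hxp, Matrix.updateRow_eq_self] at h1
      exact h1
  exact key Finset.univ A _ fun j => Or.inr ⟨Finset.mem_univ j, q j, hq j, rfl⟩

theorem mem_iSup_submodule_iff {J : Type} [Fintype J] {q : J → ProjSpace r}
    {v : Fin (r + 1) → ℂ} :
    v ∈ ⨆ j, (q j).submodule ↔ ∃ a : J → ℂ, ∑ j, a j • (q j).rep = v := by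
  rw [← Submodule.mem_span_range_iff_exists_fun, Submodule.span_range_eq_iSup]
  simp only [Projectivization.submodule_eq]

/-- A homogeneous equation of planes which holds for the general plane contained in the general
secant plane holds for all planes contained in members of `G_k(X)`. -/
theorem evalMatrix_eq_zero_of_mem_secantPlanes {h d e : ℕ} (hX : IsPreirreducible X)
    (hne : (affinePart s₀ X).Nonempty) {Ψ : MvPolynomial (Fin (h + 1) × Fin (r + 1)) ℂ}
    (hΨ : Ψ.IsHomogeneous d)
    (hg : ∀ (g : Matrix (Fin (h + 1)) (Fin (h + 1)) ℂ)
      (v : Matrix (Fin (h + 1)) (Fin (r + 1)) ℂ),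
      evalMatrix (g * v) Ψ = g.det ^ e * evalMatrix v Ψ)
    (hS : ∀ y ∈ pointFamilies (Fin (h + 1) ⊕ Fin c) (Fin (h + 1) × Fin c) (affinePart s₀ X),
      evalMatrix (secantMatrix y) Ψ = 0) (hk : h + 1 + c = k + 1)
    {H : PlaneGrassmannian k r} (hH : H ∈ secantPlanes X k)
    (v : Fin (h + 1) → Fin (r + 1) → ℂ) (hv : ∀ i, v i ∈ H.1) : evalMatrix v Ψ = 0 := by
  refine closure_minimal ?_ (isClosed_setOf_evalMatrix_eq_zero hΨ) hH v hv
  rintro H ⟨q, hq, hHq⟩ v hv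
  let ε : Fin (h + 1) ⊕ Fin c ≃ Fin (k + 1) := finSumFinEquiv.trans (finCongr hk)
  have h1 : H.1 = ⨆ j, (q (ε j)).submodule := by
    rw [hHq, ε.iSup_comp (g := fun i => (q i).submodule)]
  rw [h1] at hv
  simp only [mem_iSup_submodule_iff] at hv
  choose A hA using hv
  have h2 : v = Matrix.of A * Matrix.of fun j => (q (ε j)).rep := by
    funext i l
    rw [← hA, Matrix.mul_apply]
    simp [Finset.sum_apply]
  rw [h2]
  exact evalMatrix_mul_rep_eq_zero hX hne (fun A x hx => evalMatrix_mul_eq_zero hg hS A hx) _ _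
    fun j => hq _

/-- Independent points of an affine chart of `X` span a secant plane. -/
theorem exists_mem_secantPlanes {J : Type} [Fintype J] (ε : J ≃ Fin (k + 1))
    {x : J → Fin (r + 1) → ℂ} (hx : ∀ j, x j ∈ affinePart s₀ X) (hxi : LinearIndependent ℂ x) :
    ∃ H ∈ secantPlanes X k, ∀ j, x j ∈ H.1 := by
  have hx0 : ∀ j, x j ≠ 0 := fun j => ne_zero_of_mem_affinePart (hx j)
  refine ⟨⟨Submodule.span ℂ (Set.range x), ?_⟩, subset_closure ⟨fun i =>
    Projectivization.mk ℂ _ (hx0 (ε.symm i)), fun i => (hx _).2 _, ?_⟩, fun j =>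
    Submodule.subset_span ⟨j, rfl⟩⟩
  · rw [finrank_span_eq_card hxi, Fintype.card_congr ε, Fintype.card_fin]
  · simp only [mk_submodule]
    rw [Submodule.span_range_eq_iSup, ← ε.iSup_comp]
    simp

/-- An equation which holds for the planes contained in members of `G_k(X)` holds for
the general plane in the general secant plane. -/
theorem evalMatrix_secantMatrix_eq_zero (hX : IsPreirreducible X)
    (hne : (affinePart s₀ X).Nonempty) (hspan : Submodule.span ℂ (affinePart s₀ X) = ⊤)
    {Ψ : MvPolynomial (Fin m × Fin (r + 1)) ℂ} (hk : m + c = k + 1) (hkr : k ≤ r)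
    (h : ∀ H ∈ secantPlanes X k, ∀ v : Fin m → Fin (r + 1) → ℂ, LinearIndependent ℂ v →
      (∀ i, v i ∈ H.1) → evalMatrix v Ψ = 0) :
    ∀ y ∈ pointFamilies (Fin m ⊕ Fin c) (Fin m × Fin c) (affinePart s₀ X),
      evalMatrix (secantMatrix y) Ψ = 0 := by
  intro y hy
  rw [← aeval_secantEquation, aeval_eq_eval_complex]
  refine eval_eq_zero_of_linearIndependent (isIrreducibleSet_affinePart hX hne) hspan
    (by simp only [Fintype.card_sum, Fintype.card_fin]; omega) ?_ hy
  intro z hz hzi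
  obtain ⟨H, hH, hzH⟩ := exists_mem_secantPlanes (finSumFinEquiv.trans (finCongr hk)) hz hzi
  rw [← aeval_eq_eval_complex, aeval_secantEquation]
  refine h H hH _ (linearIndependent_secantMatrix hzi) fun i => ?_
  have h1 : secantMatrix z i = (fun l => z (Sum.inl (Sum.inl i, l))) +
      ∑ j, z (Sum.inr (i, j)) • fun l => z (Sum.inl (Sum.inr j, l)) := by
    funext l
    simp [secantMatrix, Finset.sum_apply]
  rw [h1]
  exact H.1.add_mem (hzH _) (H.1.sum_mem fun j _ => H.1.smul_mem _ (hzH _))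

/-- If the secant variety `S_k(X)` does not fill the space, then some form vanishes on the
linear spans of all `(k + 1)`-tuples of points. -/
theorem exists_form_of_secantVariety_ne_univ (hX : IsPreirreducible X)
    (hne : (affinePart s₀ X).Nonempty) (hspan : Submodule.span ℂ (affinePart s₀ X) = ⊤)
    (hkr : k ≤ r) (h : secantVariety X k ≠ Set.univ) :
    ∃ (F : MvPolynomial (Fin (r + 1)) ℂ) (d : ℕ), F.IsHomogeneous d ∧ F ≠ 0 ∧
      ∀ (b : Fin (k + 1) → ℂ) (x : Fin (k + 1) → Fin (r + 1) → ℂ),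
        (∀ j, x j ∈ affinePart s₀ X) → eval (∑ j, b j • x j) F = 0 := by
  have hcl : IsClosed (secantVariety X k) := isClosed_closure
  obtain ⟨T, hT, hTZ⟩ := isClosed_iff_exists_projZeroLocus.1 hcl
  obtain ⟨p, hp⟩ := (Set.ne_univ_iff_exists_notMem _).1 h
  have hp' : ∃ F ∈ T, eval p.rep F ≠ 0 := by
    by_contra hcon
    push Not at hcon
    refine hp ?_
    rw [hTZ]
    exact hcon
  obtain ⟨F, hFT, hFp⟩ := hp'
  obtain ⟨d, hd⟩ := hT F hFT
  have hF0 : F ≠ 0 := by rintro rfl; exact hFp (map_zero _)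
  have hFH : ∀ H ∈ secantPlanes X k, ∀ v ∈ H.1, eval v F = 0 := by
    have h1 : ∀ H ∈ secantPlanes X k, ∀ v ∈ H.1, v ≠ 0 → eval v F = 0 := by
      intro H hH v hv hv0
      rw [← eval_rep_mk_eq_zero_iff hd hv0]
      have h2 : Projectivization.mk ℂ v hv0 ∈ secantVariety X k := by
        refine subset_closure ⟨H, hH, ?_⟩
        rw [mk_submodule, Submodule.span_singleton_le_iff_mem]
        exact hv
      rw [hTZ] at h2
      exact h2 F hFT
    intro H hH v hv
    rcases eq_or_ne v 0 with rfl | hv0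
    · obtain ⟨w, hw, hw0⟩ : ∃ w ∈ H.1, w ≠ 0 :=
        ⟨_, (H.basis 0).2, fun h0 => H.basis.ne_zero 0 (Subtype.ext h0)⟩
      rw [← zero_smul ℂ w, eval_smul_of_isHomogeneous hd, h1 H hH w hw hw0, mul_zero]
    · exact h1 H hH v hv hv0
  refine ⟨F, d, hd, hF0, fun b x hx => ?_⟩
  let f : MvPolynomial (Fin (k + 1) × Fin (r + 1) ⊕ Empty) ℂ :=
    aeval (fun l => ∑ j, C (b j) * MvPolynomial.X (Sum.inl (j, l))) F
  have hf : ∀ y, eval y f = eval (∑ j, b j • fun l => y (Sum.inl (j, l))) F := by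
    intro y
    rw [← aeval_eq_eval_complex, ← aeval_eq_eval_complex, ← AlgHom.comp_apply]
    congr 1
    ext l
    simp [Finset.sum_apply]
  have h4 := eval_eq_zero_of_linearIndependent (isIrreducibleSet_affinePart hX hne) hspan
    (by simp only [Fintype.card_fin]; omega) (f := f) (fun y hy hyi => by
      obtain ⟨H, hH, hyH⟩ := exists_mem_secantPlanes (Equiv.refl _) hy hyi
      rw [hf]
      exact hFH H hH _ (H.1.sum_mem fun j _ => H.1.smul_mem _ (hyH j)))
    (y := Sum.elim (fun q => x q.1 q.2) 0) hx
  rwa [hf] at h4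

end Equations

/-! ### Dimensions of the Grassmannians of secant varieties -/

section PluckerEquation

variable {h r : ℕ}

/-- An equation in Plücker coordinates, as an equation in the entries of a matrix. -/
noncomputable def pluckerEquation (F : MvPolynomial (Fin (h + 1) → Fin (r + 1)) ℂ) :
    MvPolynomial (Fin (h + 1) × Fin (r + 1)) ℂ :=
  aeval (minors (Matrix.of fun i l => X (i, l))) F

theorem evalMatrix_pluckerEquation {A : Type*} [CommRing A] [Algebra ℂ A]
    (v : Matrix (Fin (h + 1)) (Fin (r + 1)) A)
    (F : MvPolynomial (Fin (h + 1) → Fin (r + 1)) ℂ) :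
    evalMatrix v (pluckerEquation F) = aeval (minors v) F := by
  change aeval (fun p : Fin (h + 1) × Fin (r + 1) => v p.1 p.2) (pluckerEquation F) = _
  rw [pluckerEquation, ← AlgHom.comp_apply]
  congr 1
  ext s
  rw [AlgHom.comp_apply, aeval_X, aeval_X]
  let φ : MvPolynomial (Fin (h + 1) × Fin (r + 1)) ℂ →ₐ[ℂ] A := aeval fun p => v p.1 p.2
  refine (map_minors φ.toRingHom _ s).trans ?_
  congr 1
  ext i l
  exact aeval_X _ _

theorem isHomogeneous_pluckerEquation {F : MvPolynomial (Fin (h + 1) → Fin (r + 1)) ℂ} {d : ℕ}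
    (hF : F.IsHomogeneous d) : (pluckerEquation F).IsHomogeneous ((h + 1) * d) := by
  refine hF.aeval _ fun s => ?_
  rw [minors, Matrix.det_apply]
  refine IsHomogeneous.sum _ _ _ fun σ _ => ?_
  rw [Units.smul_def, zsmul_eq_mul, ← map_intCast (C : ℂ →+* _)]
  have h1 : (∏ i, X (σ i, s i) : MvPolynomial (Fin (h + 1) × Fin (r + 1)) ℂ).IsHomogeneous
      (∑ _i : Fin (h + 1), 1) := IsHomogeneous.prod _ _ _ fun i _ => isHomogeneous_X ℂ _
  have h2 := (isHomogeneous_C (Fin (h + 1) × Fin (r + 1))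
    (((Equiv.Perm.sign σ : ℤˣ) : ℤ) : ℂ)).mul h1
  simpa using h2

theorem evalMatrix_mul_pluckerEquation {F : MvPolynomial (Fin (h + 1) → Fin (r + 1)) ℂ} {d : ℕ}
    (hF : F.IsHomogeneous d) (g : Matrix (Fin (h + 1)) (Fin (h + 1)) ℂ)
    (v : Matrix (Fin (h + 1)) (Fin (r + 1)) ℂ) :
    evalMatrix (g * v) (pluckerEquation F) = g.det ^ d * evalMatrix v (pluckerEquation F) := by
  have h1 : minors (g * v) = g.det • minors v := funext fun s => minors_mul g v s
  rw [evalMatrix_pluckerEquation, evalMatrix_pluckerEquation, h1, aeval_eq_eval_complex,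
    eval_smul_of_isHomogeneous hF, aeval_eq_eval_complex]

theorem eval_plucker_rep_eq_zero_iff {F : MvPolynomial (Fin (h + 1) → Fin (r + 1)) ℂ} {d : ℕ}
    (hF : F.IsHomogeneous d) (L : PlaneGrassmannian h r) {v : Fin (h + 1) → Fin (r + 1) → ℂ}
    (hv : ∀ i, v i ∈ L.1) (hvi : LinearIndependent ℂ v) :
    eval L.plucker.rep F = 0 ↔ evalMatrix v (pluckerEquation F) = 0 := by
  rw [plucker_eq_mk L hv (pluckerVector_ne_zero v hvi), eval_rep_mk_eq_zero_iff hF]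
  exact (evalMatrix_pluckerEquation (Matrix.of v) F).congr_left.symm

theorem pluckerVector_ne_zero_of_submatrix_eq_one {s : Fin (h + 1) → Fin (r + 1)}
    {v : Matrix (Fin (h + 1)) (Fin (r + 1)) ℂ} (hv : v.submatrix id s = 1) :
    pluckerVector v ≠ 0 := fun h0 =>
  one_ne_zero ((minors_eq_one hv).symm.trans (congrFun h0 s))

theorem eval_plucker_rowPlane_rep_eq_zero_iff {s : Fin (h + 1) → Fin (r + 1)}
    {v : Matrix (Fin (h + 1)) (Fin (r + 1)) ℂ} (hv : v.submatrix id s = 1)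
    {F : MvPolynomial (Fin (h + 1) → Fin (r + 1)) ℂ} {d : ℕ} (hF : F.IsHomogeneous d) :
    eval (rowPlane v (pluckerVector_ne_zero_of_submatrix_eq_one hv)).plucker.rep F = 0 ↔
      evalMatrix v (pluckerEquation F) = 0 :=
  eval_plucker_rep_eq_zero_iff hF _ (fun i => Submodule.subset_span ⟨i, rfl⟩)
    (linearIndependent_row_of_minors_ne_zero (v := v) (s := s)
      ((minors_eq_one hv).trans_ne one_ne_zero))

/-- The entries of a matrix in normal form are among its maximal minors, so every equation
in the entries comes from an equation in Plücker coordinates. -/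
theorem exists_pluckerEquation_eq (s : Fin (h + 1) → Fin (r + 1))
    (f : MvPolynomial (Fin (h + 1) × Fin (r + 1)) ℂ) :
    ∃ (F : MvPolynomial (Fin (h + 1) → Fin (r + 1)) ℂ) (d : ℕ), F.IsHomogeneous d ∧
      ∀ v : Matrix (Fin (h + 1)) (Fin (r + 1)) ℂ, v.submatrix id s = 1 →
        evalMatrix v (pluckerEquation F) = evalMatrix v f := by
  obtain ⟨d, F, hF, hFe⟩ := exists_homogenization s
    (rename (fun p : Fin (h + 1) × Fin (r + 1) => Function.update s p.1 p.2) f)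
  refine ⟨F, d, hF, fun v hv => ?_⟩
  have hs : minors v s = 1 := minors_eq_one hv
  have h1 := hFe (minors v) (hs.trans_ne one_ne_zero)
  rw [hs, one_pow, one_mul, inv_one, one_smul, aeval_rename] at h1
  rw [evalMatrix_pluckerEquation, h1]
  refine congrArg (fun w => aeval w f) (funext fun p => ?_)
  exact minors_update_of_submatrix_eq_one hv p.1 p.2

end PluckerEquation

section Dimension

variable {r k h c : ℕ} {X : Set (ProjSpace r)} {s₀ : Fin (r + 1)}
  {K : Type} [Field K] [Algebra ℂ K]
  {η : (Fin (h + 1) ⊕ Fin c) × Fin (r + 1) ⊕ Fin (h + 1) × Fin c → K}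

/-- Lower bound for the dimension of `G_{h,k}(X)`: an affine chart of it contains the affine
variety whose generic point is the normal form of the secant matrix. -/
theorem eRk_normalForm_le_topologicalKrullDim (hX : IsPreirreducible X)
    (hne : (affinePart s₀ X).Nonempty) (hspan : Submodule.span ℂ (affinePart s₀ X) = ⊤)
    (hη : IsFieldGeneric (pointFamilies (Fin (h + 1) ⊕ Fin c) (Fin (h + 1) × Fin c)
      (affinePart s₀ X)) η)
    {s : Fin (h + 1) → Fin (r + 1)} (hs : minors (secantMatrix η) s ≠ 0)
    (hk : h + 1 + c = k + 1) (hkr : k ≤ r) :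
    ((algMatroid K).eRk (Set.range fun p : Fin (h + 1) × Fin (r + 1) =>
      normalForm (secantMatrix η) s p.1 p.2) : WithBot ℕ∞) ≤
      topologicalKrullDim (secantGrassmannian X h k) := by
  set N := normalForm (secantMatrix η) s with hN
  rw [← ringKrullDim_quotient_ker_aeval]
  set P := RingHom.ker (aeval (R := ℂ) fun p : Fin (h + 1) × Fin (r + 1) => N p.1 p.2) with hP
  let V : zeroLocus ℂ P → Matrix (Fin (h + 1)) (Fin (r + 1)) ℂ := fun x i l => x.1 (i, l)
  have hV : ∀ x, (V x).submatrix id s = 1 := by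
    intro x
    ext i j
    have h1 : MvPolynomial.X (i, s j) -
        MvPolynomial.C ((1 : Matrix (Fin (h + 1)) (Fin (h + 1)) ℂ) i j) ∈ P := by
      have h2 := congrFun (congrFun (normalForm_submatrix hs) i) j
      rw [hP, RingHom.mem_ker, map_sub, aeval_X, aeval_C, sub_eq_zero]
      refine h2.trans ?_
      rcases eq_or_ne i j with rfl | hij
      · simp
      · simp [hij]
    have h2 := x.2 _ h1
    rw [aeval_eq_eval_complex, map_sub, eval_X, eval_C, sub_eq_zero] at h2
    exact h2
  have hcl : IsClosed (secantGrassmannian X h k) := isClosed_closure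
  have hmem : ∀ x, rowPlane (V x) (pluckerVector_ne_zero_of_submatrix_eq_one (hV x)) ∈
      secantGrassmannian X h k := by
    intro x
    obtain ⟨C, hC, hCZ⟩ := isClosed_induced_iff.1 hcl
    obtain ⟨T, hT, rfl⟩ := isClosed_iff_exists_projZeroLocus.1 hC
    rw [← hCZ]
    intro F hF
    obtain ⟨d, hd⟩ := hT F hF
    rw [eval_plucker_rowPlane_rep_eq_zero_iff (hV x) hd]
    refine x.2 (pluckerEquation F) ?_
    have h1 : evalMatrix (secantMatrix η) (pluckerEquation F) = 0 := by
      rw [hη.evalMatrix_secantMatrix_eq_zero_iff]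
      refine evalMatrix_secantMatrix_eq_zero hX hne hspan hk hkr fun H hH v hvi hv => ?_
      have h2 : rowPlane v (pluckerVector_ne_zero v hvi) ∈ secantGrassmannian X h k :=
        subset_closure ⟨H, hH, Submodule.span_le.2 (Set.range_subset_iff.2 hv)⟩
      rw [← hCZ] at h2
      exact (eval_plucker_rep_eq_zero_iff hd (rowPlane v (pluckerVector_ne_zero v hvi))
        (fun i => Submodule.subset_span ⟨i, rfl⟩) hvi).1 (h2 F hF)
    have h2 : minors (secantMatrix η) = minors (secantMatrix η) s • minors N :=
      funext fun t => minors_eq_mul_minors_normalForm hs t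
    rw [evalMatrix_pluckerEquation, h2, aeval_smul_of_isHomogeneous hd, mul_eq_zero] at h1
    exact (evalMatrix_pluckerEquation N F).trans (h1.resolve_left (pow_ne_zero _ hs))
  refine ringKrullDim_le_topologicalKrullDim P (fun x => ⟨_, hmem x⟩) ?_ ?_
  · intro C hC
    obtain ⟨C', hC', rfl⟩ := isClosed_induced_iff.1 hC
    obtain ⟨C'', hC'', rfl⟩ := isClosed_induced_iff.1 hC'
    obtain ⟨T, hT, rfl⟩ := isClosed_iff_exists_projZeroLocus.1 hC''
    refine ⟨pluckerEquation '' T, fun x => ?_⟩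
    rw [Set.forall_mem_image]
    refine forall₂_congr fun F hF => ?_
    obtain ⟨d, hd⟩ := hT F hF
    exact eval_plucker_rowPlane_rep_eq_zero_iff (hV x) hd
  · intro f
    obtain ⟨F, d, hF, hFe⟩ := exists_pluckerEquation_eq s f
    refine ⟨_, ((isClosed_setOf_eval_rep_eq_zero hF).preimage
      continuous_induced_dom).preimage continuous_subtype_val, fun x => ?_⟩
    refine (eval_plucker_rowPlane_rep_eq_zero_iff (hV x) hF).trans ?_
    rw [hFe _ (hV x)]
    rfl

/-- Upper bound for the dimension of `G_{h,k}(X)`: all planes in it are specializations of the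
row space of the secant matrix. -/
theorem topologicalKrullDim_secantGrassmannian_le (hX : IsPreirreducible X)
    (hne : (affinePart s₀ X).Nonempty)
    (hη : IsFieldGeneric (pointFamilies (Fin (h + 1) ⊕ Fin c) (Fin (h + 1) × Fin c)
      (affinePart s₀ X)) η)
    {s : Fin (h + 1) → Fin (r + 1)} (hs : minors (secantMatrix η) s ≠ 0)
    (hk : h + 1 + c = k + 1) :
    topologicalKrullDim (secantGrassmannian X h k) ≤
      ((algMatroid K).eRk (Set.range fun p : Fin (h + 1) × Fin (r + 1) =>
        normalForm (secantMatrix η) s p.1 p.2) : WithBot ℕ∞) := by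
  have h1 : Topology.IsInducing (PlaneGrassmannian.plucker (h := h) (r := r)) := ⟨rfl⟩
  have h2 : Topology.IsInducing ((secantGrassmannian X h k).mapsTo_image
      PlaneGrassmannian.plucker).restrict := by
    refine Topology.IsInducing.of_comp ?_ continuous_subtype_val ?_
    · exact (h1.continuous.comp continuous_subtype_val).subtype_mk _
    · exact h1.comp Topology.IsInducing.subtypeVal
  refine h2.topologicalKrullDim_le.trans ?_
  refine topologicalKrullDim_le_of_generic _ (minors (secantMatrix η)) ?_ _
    fun t _ => eRk_ratio_minors_le hs t
  rintro F d hF hF0 _ ⟨L, hL, rfl⟩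
  rw [← evalMatrix_pluckerEquation, hη.evalMatrix_secantMatrix_eq_zero_iff] at hF0
  refine closure_minimal (t := PlaneGrassmannian.plucker ⁻¹' {p | eval p.rep F = 0}) ?_
    ((isClosed_setOf_eval_rep_eq_zero hF).preimage continuous_induced_dom) hL
  rintro L ⟨H, hH, hLH⟩
  have hLi : LinearIndependent ℂ fun i => (L.basis i : Fin (r + 1) → ℂ) :=
    L.basis.linearIndependent.map' L.1.subtype (Submodule.ker_subtype L.1)
  exact (eval_plucker_rep_eq_zero_iff hF L (fun i => (L.basis i).2) hLi).2
    (evalMatrix_eq_zero_of_mem_secantPlanes hX hne (isHomogeneous_pluckerEquation hF)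
      (evalMatrix_mul_pluckerEquation hF) hF0 hk hH _ fun i => hLH (L.basis i).2)

/-- The same upper bound for the secant variety `S_k(X)`, which corresponds to `h = 0`. -/
theorem topologicalKrullDim_secantVariety_le (hX : IsPreirreducible X)
    (hne : (affinePart s₀ X).Nonempty)
    {η : (Fin 1 ⊕ Fin k) × Fin (r + 1) ⊕ Fin 1 × Fin k → K}
    (hη : IsFieldGeneric (pointFamilies (Fin 1 ⊕ Fin k) (Fin 1 × Fin k)
      (affinePart s₀ X)) η)
    {s : Fin 1 → Fin (r + 1)} (hs : minors (secantMatrix η) s ≠ 0) :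
    topologicalKrullDim (secantVariety X k) ≤
      ((algMatroid K).eRk (Set.range fun p : Fin 1 × Fin (r + 1) =>
        normalForm (secantMatrix η) s p.1 p.2) : WithBot ℕ∞) := by
  have hmin : ∀ (v : Matrix (Fin 1) (Fin (r + 1)) K) l, minors v (fun _ => l) = v 0 l := by
    intro v l
    rw [minors, Matrix.det_fin_one]; rfl
  have hrow : ∀ {A : Type} [CommRing A] [Algebra ℂ A] (v : Matrix (Fin 1) (Fin (r + 1)) A)
      (F : MvPolynomial (Fin (r + 1)) ℂ),
      evalMatrix v (rename (fun l => ((0 : Fin 1), l)) F) = aeval (v 0) F := by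
    intro A _ _ v F
    exact aeval_rename _ _ _
  refine topologicalKrullDim_le_of_generic _ (secantMatrix η 0) ?_ _ fun t _ => ?_
  · intro F d hF hF0 p hp
    rw [← hrow, hη.evalMatrix_secantMatrix_eq_zero_iff] at hF0
    refine closure_minimal ?_ (isClosed_setOf_eval_rep_eq_zero hF) hp
    rintro p ⟨H, hH, hpH⟩
    have h1 := evalMatrix_eq_zero_of_mem_secantPlanes (h := 0) (e := d) hX hne
      (IsHomogeneous.rename_isHomogeneous hF)
      (fun g v => by
        rw [hrow, hrow, aeval_eq_eval_complex, aeval_eq_eval_complex,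
          ← eval_smul_of_isHomogeneous hF]
        congr 2
        funext l
        simp [Matrix.mul_apply]) hF0 (by omega) hH (fun _ => p.rep)
      fun _ => hpH (rep_mem_submodule p)
    exact (hrow (fun _ => p.rep) F).symm.trans h1
  · refine eRk_le_of_subset_adjoin ?_
    rintro _ ⟨l, rfl⟩
    have h1 := minors_eq_mul_minors_normalForm hs
    have h2 : ((secantMatrix η 0 t)⁻¹ • secantMatrix η 0) l =
        (normalForm (secantMatrix η) s 0 t)⁻¹ * normalForm (secantMatrix η) s 0 l := by
      have h3 := h1 fun _ => t
      have h4 := h1 fun _ => l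
      rw [hmin, hmin] at h3 h4
      rw [Pi.smul_apply, smul_eq_mul, h3, h4]
      field_simp
    rw [h2]
    exact mul_mem (inv_mem (IntermediateField.subset_adjoin _ _ ⟨(0, t), rfl⟩))
      (IntermediateField.subset_adjoin _ _ ⟨(0, l), rfl⟩)

/-- The dimension of projective space is at least `r`. -/
theorem le_topologicalKrullDim_univ (r : ℕ) :
    (r : WithBot ℕ∞) ≤ topologicalKrullDim (Set.univ : Set (ProjSpace r)) := by
  let K := FractionRing (MvPolynomial (Fin r) ℂ)
  let x : Fin r → K := fun i => algebraMap (MvPolynomial (Fin r) ℂ) K (MvPolynomial.X i)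
  have hx : AlgebraicIndependent ℂ x :=
    (MvPolynomial.algebraicIndependent_X (Fin r) ℂ).map'
      (f := IsScalarTower.toAlgHom ℂ (MvPolynomial (Fin r) ℂ) K)
      (IsFractionRing.injective (MvPolynomial (Fin r) ℂ) K)
  let y : Fin (r + 1) → K := Fin.cons 1 x
  have h1 : (r : ℕ∞) ≤ (algMatroid K).eRk (Set.range y) := by
    have h2 := eRk_range_eq_card hx
    rw [Fintype.card_fin] at h2
    rw [← h2]
    refine (algMatroid K).eRk_mono ?_
    rintro _ ⟨i, rfl⟩
    exact ⟨i.succ, rfl⟩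
  refine (WithBot.coe_le_coe.2 h1).trans (eRk_le_topologicalKrullDim isClosed_univ y (s := 0)
    rfl fun F d hF h => ?_)
  have hF0 : ∀ v : Fin (r + 1) → ℂ, v ≠ 0 → eval v F = 0 := fun v hv =>
    (eval_rep_mk_eq_zero_iff hF hv).1 (h _ trivial)
  have h3 : F * MvPolynomial.X 0 = 0 := MvPolynomial.funext fun v => by
    rcases eq_or_ne v 0 with rfl | hv
    · simp
    · simp [hF0 v hv]
  rw [(mul_eq_zero.1 h3).resolve_right (MvPolynomial.X_ne_zero 0), map_zero]

end Dimension

/-! ### Defective secant planes -/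

section Defective

variable {ρ : Type}

/-- The general `(m - 1)`-plane contained in the span of `m + c` general points of `S` lies in the
spans of infinitely many families of `m + c` points: its coordinates have smaller transcendence
degree than the points together with the parameters of the plane. -/
def IsSecantDefective (S : Set (ρ → ℂ)) (m c : ℕ) : Prop :=
  ∃ (K : Type) (_ : Field K) (_ : Algebra ℂ K) (η : (Fin m ⊕ Fin c) × ρ ⊕ Fin m × Fin c → K)
    (s : Fin m → ρ), IsFieldGeneric (pointFamilies (Fin m ⊕ Fin c) (Fin m × Fin c) S) η ∧
      minors (secantMatrix η) s ≠ 0 ∧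
      (algMatroid K).eRk (Set.range fun p : Fin m × ρ => normalForm (secantMatrix η) s p.1 p.2) <
        (algMatroid K).eRk (Set.range η)

theorem exists_minors_secantMatrix_ne_zero [Fintype ρ] {S : Set (ρ → ℂ)}
    (hspan : Submodule.span ℂ S = ⊤) {m c : ℕ} (hc : m + c ≤ Fintype.card ρ)
    {K : Type} [Field K] [Algebra ℂ K] {η : (Fin m ⊕ Fin c) × ρ ⊕ Fin m × Fin c → K}
    (hη : IsFieldGeneric (pointFamilies (Fin m ⊕ Fin c) (Fin m × Fin c) S) η) :
    ∃ s, minors (secantMatrix η) s ≠ 0 :=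
  exists_minors_ne_zero (linearIndependent_secantMatrix
    (hη.linearIndependent hspan (by simpa only [Fintype.card_sum, Fintype.card_fin] using hc)))

theorem eval_sum_eq_zero_of_card_le {ι : Type} [Fintype ι] {S : Set (ρ → ℂ)} (hS : S.Nonempty)
    {F : MvPolynomial ρ ℂ} {N : ℕ}
    (hF : ∀ (b : Fin N → ℂ) (x : Fin N → ρ → ℂ), (∀ j, x j ∈ S) → eval (∑ j, b j • x j) F = 0)
    (hN : Fintype.card ι ≤ N + 1) (j₀ : ι) (b : ι → ℂ) (x : ι → ρ → ℂ) (hb : b j₀ = 0)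
    (hx : ∀ j, x j ∈ S) : eval (∑ j, b j • x j) F = 0 := by
  classical
  obtain ⟨x₀, hx₀⟩ := hS
  obtain ⟨e⟩ : Nonempty ({j // j ≠ j₀} ↪ Fin N) := Function.Embedding.nonempty_of_card_le (by
    rw [Fintype.card_subtype_compl, Fintype.card_subtype_eq, Fintype.card_fin]; omega)
  let x' : Fin N → ρ → ℂ := Function.extend e (fun j => x j) fun _ => x₀
  have hx' : ∀ i, x' i ∈ S := by
    intro i
    by_cases hi : ∃ j, e j = i
    · obtain ⟨j, rfl⟩ := hi
      simp only [x', e.injective.extend_apply]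
      exact hx j
    · simp only [x', Function.extend_apply' _ _ _ hi]
      exact hx₀
  have h1 : ∑ j, b j • x j ∈ Submodule.span ℂ (Set.range x') := by
    refine Submodule.sum_mem _ fun j _ => ?_
    rcases eq_or_ne j j₀ with rfl | hj
    · rw [hb, zero_smul]
      exact Submodule.zero_mem _
    · exact Submodule.smul_mem _ _ (Submodule.subset_span
        ⟨e ⟨j, hj⟩, e.injective.extend_apply _ _ _⟩)
  obtain ⟨b', hb'⟩ := (Submodule.mem_span_range_iff_exists_fun ℂ).1 h1
  rw [← hb']
  exact hF b' x' hx'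

variable [Fintype ρ] {S : Set (ρ → ℂ)} {l₀ : ρ} {F : MvPolynomial ρ ℂ} {d N : ℕ}

theorem IsSecantDefective.tail (hS : IsIrreducibleSet S)
    (hspan : ∀ c : ρ → ℂ, (∀ x ∈ S, ∑ l, c l * x l = 0) → c = 0)
    (hl₀ : ∀ x ∈ S, x l₀ = 1) (hF : F.IsHomogeneous d) (hF0 : F ≠ 0)
    (hFS : ∀ (b : Fin N → ℂ) (x : Fin N → ρ → ℂ), (∀ j, x j ∈ S) → eval (∑ j, b j • x j) F = 0)
    {m c : ℕ} (hN : m + c ≤ N) (hc : m + c ≤ Fintype.card ρ) (h : IsSecantDefective S (m + 1) c) :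
    IsSecantDefective S m c := by
  obtain ⟨K, _, _, η, s, hη, hs, hlt⟩ := h
  have hη' := hη.tail hS.nonempty
  obtain ⟨s', hs'⟩ := exists_minors_secantMatrix_ne_zero
    (span_eq_top_of_forall_sum_mul_eq_zero hspan) hc hη'
  exact ⟨K, _, _, η ∘ tailIndex, s', hη', hs', eRk_normalForm_tail_lt hS hspan hl₀ hF hF0
    (fun j₀ b x hb hx => eval_sum_eq_zero_of_card_le hS.nonempty hFS
      (by simp only [Fintype.card_sum, Fintype.card_fin]; omega) j₀ b x hb hx) hη hs hs' hlt⟩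

theorem IsSecantDefective.one (hS : IsIrreducibleSet S)
    (hspan : ∀ c : ρ → ℂ, (∀ x ∈ S, ∑ l, c l * x l = 0) → c = 0)
    (hl₀ : ∀ x ∈ S, x l₀ = 1) (hF : F.IsHomogeneous d) (hF0 : F ≠ 0)
    (hFS : ∀ (b : Fin N → ℂ) (x : Fin N → ρ → ℂ), (∀ j, x j ∈ S) → eval (∑ j, b j • x j) F = 0)
    {m c : ℕ} (hN : m + c ≤ N) (hc : m + c ≤ Fintype.card ρ) (h : IsSecantDefective S (m + 1) c) :
    IsSecantDefective S 1 c := by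
  induction m with
  | zero => exact h
  | succ m ih =>
    exact ih (by omega) (by omega) (h.tail hS hspan hl₀ hF hF0 hFS hN hc)

end Defective

section Variety

variable {r n : ℕ} {X : Set (ProjSpace r)} {s₀ : Fin (r + 1)} {c h k : ℕ}

theorem IsNondegenerateVariety.eRk_range_eq (hX : IsNondegenerateVariety n X)
    (hne : (affinePart s₀ X).Nonempty) {m : ℕ} {K : Type} [Field K] [Algebra ℂ K]
    {η : (Fin m ⊕ Fin c) × Fin (r + 1) ⊕ Fin m × Fin c → K}
    (hη : IsFieldGeneric (pointFamilies (Fin m ⊕ Fin c) (Fin m × Fin c) (affinePart s₀ X)) η) :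
    (algMatroid K).eRk (Set.range η) = ((m + c) * n + m * c : ℕ) := by
  obtain ⟨K₀, _, _, ξ, hξ⟩ := (isIrreducibleSet_affinePart
    hX.isIrreducible.isPreirreducible hne).exists_isFieldGeneric
  have h1 := eRk_range_pointFamilies hη hne hξ (hX.eRk_eq hne hξ)
  simpa only [Nat.card_sum, Nat.card_prod, Nat.card_fin] using h1

theorem isSecantDefective_of_topologicalKrullDim_lt (hX : IsNondegenerateVariety n X)
    (hne : (affinePart s₀ X).Nonempty) (hk : h + 1 + c = k + 1) (hkr : k ≤ r)
    (hdim : topologicalKrullDim (secantGrassmannian X h k) <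
      (((h + 1 + c) * n + (h + 1) * c : ℕ) : WithBot ℕ∞)) :
    IsSecantDefective (affinePart s₀ X) (h + 1) c := by
  have hS := isIrreducibleSet_affinePart hX.isIrreducible.isPreirreducible hne
  have hspan := span_eq_top_of_forall_sum_mul_eq_zero (hX.eq_zero_of_sum_mul_eq_zero hne)
  obtain ⟨K, _, _, η, hη⟩ := (hS.pointFamilies (ι := Fin (h + 1) ⊕ Fin c)
    (κ := Fin (h + 1) × Fin c)).exists_isFieldGeneric
  obtain ⟨s, hs⟩ := exists_minors_secantMatrix_ne_zero hspan
    (by rw [Fintype.card_fin]; omega) hη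
  refine ⟨K, _, _, η, s, hη, hs, ?_⟩
  rw [hX.eRk_range_eq hne hη]
  exact_mod_cast (eRk_normalForm_le_topologicalKrullDim hX.isIrreducible.isPreirreducible hne hspan
    hη hs hk hkr).trans_lt hdim

theorem IsSecantDefective.topologicalKrullDim_secantGrassmannian_lt
    (hX : IsNondegenerateVariety n X) (hne : (affinePart s₀ X).Nonempty)
    (hk : h + 1 + c = k + 1) (hdef : IsSecantDefective (affinePart s₀ X) (h + 1) c) :
    topologicalKrullDim (secantGrassmannian X h k) <
      (((h + 1 + c) * n + (h + 1) * c : ℕ) : WithBot ℕ∞) := by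
  obtain ⟨K, _, _, η, s, hη, hs, hlt⟩ := hdef
  rw [hX.eRk_range_eq hne hη] at hlt
  refine (topologicalKrullDim_secantGrassmannian_le hX.isIrreducible.isPreirreducible hne hη hs
    hk).trans_lt ?_
  exact_mod_cast hlt

theorem IsSecantDefective.topologicalKrullDim_secantVariety_lt
    (hX : IsNondegenerateVariety n X) (hne : (affinePart s₀ X).Nonempty)
    (hdef : IsSecantDefective (affinePart s₀ X) 1 c) :
    topologicalKrullDim (secantVariety X c) < (((1 + c) * n + 1 * c : ℕ) : WithBot ℕ∞) := by
  obtain ⟨K, _, _, η, s, hη, hs, hlt⟩ := hdef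
  rw [hX.eRk_range_eq hne hη] at hlt
  refine (topologicalKrullDim_secantVariety_le hX.isIrreducible.isPreirreducible hne hη
    hs).trans_lt ?_
  exact_mod_cast hlt

theorem IsNondegenerateVariety.topologicalKrullDim_secantVariety_le
    (hX : IsNondegenerateVariety n X) (hkr : k ≤ r) :
    topologicalKrullDim (secantVariety X k) ≤ (((1 + k) * n + 1 * k : ℕ) : WithBot ℕ∞) := by
  obtain ⟨s₀, hne⟩ := exists_affinePart_nonempty hX.isIrreducible.nonempty
  have hS := isIrreducibleSet_affinePart hX.isIrreducible.isPreirreducible hne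
  have hspan := span_eq_top_of_forall_sum_mul_eq_zero (hX.eq_zero_of_sum_mul_eq_zero hne)
  obtain ⟨K, _, _, η, hη⟩ := (hS.pointFamilies (ι := Fin 1 ⊕ Fin k)
    (κ := Fin 1 × Fin k)).exists_isFieldGeneric
  obtain ⟨s, hs⟩ := exists_minors_secantMatrix_ne_zero hspan
    (by rw [Fintype.card_fin]; omega) hη
  refine (_root_.topologicalKrullDim_secantVariety_le hX.isIrreducible.isPreirreducible hne hη
    hs).trans ?_
  have h1 := hX.eRk_range_eq hne hη
  have h2 : (algMatroid K).eRk (Set.range fun p : Fin 1 × Fin (r + 1) =>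
      normalForm (secantMatrix η) s p.1 p.2) ≤ (algMatroid K).eRk (Set.range η) :=
    eRk_le_of_subset_adjoin (by
      rintro _ ⟨p, rfl⟩
      exact normalForm_secantMatrix_mem_adjoin _ _ _ _)
  rw [h1] at h2
  exact_mod_cast h2

theorem topologicalKrullDim_lt_of_secantVariety_ne_univ (hX : IsNondegenerateVariety n X)
    (h1 : 1 ≤ h) (hhk : h < k) (hkr : k ≤ r) (huniv : secantVariety X (k - 1) ≠ Set.univ)
    (hdim : topologicalKrullDim (secantGrassmannian X h k) <
      (((k - h) * (h + 1) + n * (k + 1) : ℕ) : WithBot ℕ∞)) :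
    topologicalKrullDim (secantGrassmannian X (h - 1) (k - 1)) <
        (((k - h) * h + n * k : ℕ) : WithBot ℕ∞) ∧
      topologicalKrullDim (secantVariety X (k - h)) <
        ((n * (k - h + 1) + (k - h) : ℕ) : WithBot ℕ∞) := by
  obtain ⟨c, rfl⟩ := Nat.exists_eq_add_of_lt hhk
  obtain ⟨h, rfl⟩ := Nat.exists_eq_add_of_le' h1
  have e1 : h + 1 + c + 1 - 1 = h + 1 + c := by omega
  have e2 : h + 1 + c + 1 - (h + 1) = c + 1 := by omega
  have e3 : h + 1 - 1 = h := by omega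
  rw [e1] at huniv
  rw [e2] at hdim
  rw [e1, e2, e3]
  obtain ⟨s₀, hne⟩ := exists_affinePart_nonempty hX.isIrreducible.nonempty
  have hXi := hX.isIrreducible.isPreirreducible
  have hS := isIrreducibleSet_affinePart hXi hne
  have hlin := hX.eq_zero_of_sum_mul_eq_zero hne
  obtain ⟨F, d, hF, hF0, hFS⟩ := exists_form_of_secantVariety_ne_univ hXi hne
    (span_eq_top_of_forall_sum_mul_eq_zero hlin) (by omega) huniv
  have hcard := Fintype.card_fin (r + 1)
  have hdef : IsSecantDefective (affinePart s₀ X) (h + 1 + 1) (c + 1) :=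
    isSecantDefective_of_topologicalKrullDim_lt hX hne (by omega) hkr (hdim.trans_eq
      (congrArg Nat.cast (by ring)))
  have hl₀ : ∀ x ∈ affinePart s₀ X, x s₀ = 1 := fun x hx => hx.1
  refine ⟨?_, ?_⟩
  · refine ((hdef.tail hS hlin hl₀ hF hF0 hFS (by omega)
      (by omega)).topologicalKrullDim_secantGrassmannian_lt hX hne (by omega)).trans_eq
        (congrArg Nat.cast (by ring))
  · refine ((hdef.one hS hlin hl₀ hF hF0 hFS (by omega)
      (by omega)).topologicalKrullDim_secantVariety_lt hX hne).trans_eq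
        (congrArg Nat.cast (by ring))

end Variety

theorem theorem1p8 (r n : ℕ) (X : Set (ProjSpace r)) (hX : IsNondegenerateVariety n X) :
    (∀ h k : ℕ, 1 ≤ h → h < k → k ≤ r →
      secantVariety X (k - 1) ≠ Set.univ →
      topologicalKrullDim (secantGrassmannian X h k) <
        (((k - h) * (h + 1) + n * (k + 1) : ℕ) : WithBot ℕ∞) →
      topologicalKrullDim (secantGrassmannian X (h - 1) (k - 1)) <
          (((k - h) * h + n * k : ℕ) : WithBot ℕ∞) ∧
        topologicalKrullDim (secantVariety X (k - h)) <
          ((n * (k - h + 1) + (k - h) : ℕ) : WithBot ℕ∞)) ∧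
    (2 * n + 1 < r →
      topologicalKrullDim (secantGrassmannian X 1 2) < ((3 * n + 2 : ℕ) : WithBot ℕ∞) →
      topologicalKrullDim (secantVariety X 1) < ((2 * n + 1 : ℕ) : WithBot ℕ∞)) := by
  have key : ∀ h k : ℕ, 1 ≤ h → h < k → k ≤ r → secantVariety X (k - 1) ≠ Set.univ → _ → _ :=
    fun h k h1 hhk hkr => topologicalKrullDim_lt_of_secantVariety_ne_univ hX (h := h) h1 hhk hkr
  refine ⟨key, fun hr hdim => ?_⟩
  have huniv : secantVariety X 1 ≠ Set.univ := by
    intro hcon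
    have h1 := (le_topologicalKrullDim_univ r).trans
      (hcon ▸ hX.topologicalKrullDim_secantVariety_le (k := 1) (by omega))
    have h2 : r ≤ (1 + 1) * n + 1 * 1 := by exact_mod_cast h1
    omega
  refine (key 1 2 le_rfl (by omega) (by omega) huniv (hdim.trans_eq
    (congrArg Nat.cast (by omega)))).2.trans_eq (congrArg Nat.cast (by omega))
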